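/- Let $d\ge 1$, $0<a<b<\infty$, $L>1$, let $\mathbb{A}_{a,b}=\{z\in\mathbb{C}: a<|z|<b\}$ and $\mathcal{A}_{a,b}=\mathbb{A}_{a,b}\times\mathbb{S}^{d-1}$, where $\mathbb{S}^{d-1}$ is the unit sphere of $\mathbb{R}^d$ with surface measure $d\theta$. For $k\ge 0$ let $\mathcal{H}_k(\mathbb{R}^d)$ be the space of complex harmonic homogeneous polynomials of degree $k$, let $a_k$ be its dimension, and let real polynomials $Y_{k,\ell}$, $\ell=1,\dots,a_k$, form an orthonormal basis of it for the scalar product $\int_{\mathbb{S}^{d-1}} f\overline{g}\,d\theta$. Let $H^2(\mathbb{A}_{a,b})$ be the space of analytic functions $f$ on $\mathbb{A}_{a,b}$ with $\sup_{a<r<b}\frac1{2\pi}\int_0^{2\pi}|f(re^{i\varphi})|^2\,d\varphi<\infty$, with the inner product $$\langle f,g\rangle_{H^2}=\lim_{r\to a+}\frac1{2\pi}\int_0^{2\pi} f(re^{i\varphi})\overline{g(re^{i\varphi})}\,d\varphi+\lim_{r\to b-}\frac1{2\pi}\int_0^{2\pi} f(re^{i\varphi})\overline{g(re^{i\varphi})}\,d\varphi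 ,$$ and let $H^{2,k}$ be the closure in $H^2(\mathbb{A}_{a,b})$ of the linear span of the functions $z^{k+2j}$ and $z^{-d-k+2+2j}$, $j=0,1,2,\dots$. The polyharmonic Hardy space $H_L^2(\mathcal{A}_{a,b})$ consists of all functions $$f(z,\theta)=\sum_{k=0}^\infty\sum_{\ell=1}^{a_k} f_{k,\ell}(z)Y_{k,\ell}(\theta),\qquad f_{k,\ell}\in H^{2,k},\qquad \sum_{k,\ell}\|f_{k,\ell}\|_{H^2}^2L^{2k}<\infty .$$ Then for all $f_{k,\ell}\in H^{2,k}$ with $\sum_{k,\ell}\|f_{k,\ell}\|_{H^2}^2L^{2k}<\infty$ this series converges unconditionally at every point of $\mathcal{A}_{a,b}$; $H_L^2(\mathcal{A}_{a,b})$ is a complex vector space, and $\langle f,g\rangle_{H_L^2}=\sum_{k,\ell}\langle f_{k,\ell},g_{k,\ell}\rangle_{H^2}L^{2k}$ is a well-defined inner product on it. With the norm $\|f\|_{H_L^2}=\langle f,f\rangle_{H_L^2}^{1/2}$ the following hold. 1. $H_L^2(\mathcal{A}_{a,b})$ is complete, so it is a Hilbert space. 2. (Maximum principle) For every compact $K\subset\mathcal{A}_{a,b}$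 there is a constant $C>0$ such that for all $f\in H_L^2(\mathcal{A}_{a,b})$ and all $(z,\theta)\in K$ $$|f(z,\theta)|\le\frac{C}{\min\left(1-|z|/b,\ |z|/a-1\right)}\,\|f\|_{H_L^2}.$$ 3. Every $f\in H_L^2(\mathcal{A}_{a,b})$ is $C^\infty$ on $\mathcal{A}_{a,b}$ (jointly in $z$ and $\theta$, as a function on a real manifold). -/

import Mathlib

open Set Filter Topology MeasureTheory
open scoped Manifold ContDiff ComplexConjugate

noncomputable section

namespace PolyharmonicHardy

/-! ### Spherical harmonics -/

/-- The space `𝓗_k(ℝ^d)` of all complex harmonic homogeneous polynomials of degree `k`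
in `d` variables (the solid harmonics of degree `k`). -/
def solidHarmonics (d k : ℕ) : Submodule ℂ (MvPolynomial (Fin d) ℂ) :=
  MvPolynomial.homogeneousSubmodule (Fin d) ℂ k ⊓
    LinearMap.ker (∑ i : Fin d,
      ((MvPolynomial.pderiv i : Derivation ℂ (MvPolynomial (Fin d) ℂ) _) :
          MvPolynomial (Fin d) ℂ →ₗ[ℂ] MvPolynomial (Fin d) ℂ) ∘ₗ
        ((MvPolynomial.pderiv i : Derivation ℂ (MvPolynomial (Fin d) ℂ) _) :
          MvPolynomial (Fin d) ℂ →ₗ[ℂ] MvPolynomial (Fin d) ℂ))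

/-- The unit sphere `𝕊^{d-1}` of `ℝ^d`. -/
abbrev Sphere (d : ℕ) : Type := Metric.sphere (0 : EuclideanSpace ℝ (Fin d)) 1

/-- The index set of all pairs `(k, ℓ)` with `k ≥ 0` and `ℓ` running through `a_k` values,
where `a_k` is the dimension of `𝓗_k(ℝ^d)`. -/
abbrev Index (d : ℕ) : Type := Σ k : ℕ, Fin (Module.finrank ℂ (solidHarmonics d k))

/-- The value at a point of the sphere of a real polynomial in `d` variables. -/
def onSphere {d : ℕ} (p : MvPolynomial (Fin d) ℝ) (θ : Sphere d) : ℝ :=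
  MvPolynomial.eval (fun i => (θ : EuclideanSpace ℝ (Fin d)) i) p

/-- The real polynomials `Y_{k,ℓ}`, `ℓ = 1, …, a_k`, form for every `k` an orthonormal basis of
`𝓗_k(ℝ^d)` with respect to the scalar product `∫ f(θ) conj (g(θ)) dθ` over the sphere;
`dθ` is the surface measure. -/
structure IsHarmonicBasis {d : ℕ} (Y : Index d → MvPolynomial (Fin d) ℝ) : Prop where
  span_eq : ∀ k : ℕ,
    Submodule.span ℂ (range fun l => MvPolynomial.map (algebraMap ℝ ℂ) (Y ⟨k, l⟩)) =
      solidHarmonics d k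
  orthonormal : ∀ (k : ℕ) (l m : Fin (Module.finrank ℂ (solidHarmonics d k))),
    ∫ θ : Sphere d, onSphere (Y ⟨k, l⟩) θ * onSphere (Y ⟨k, m⟩) θ
      ∂(volume : Measure (EuclideanSpace ℝ (Fin d))).toSphere = if l = m then 1 else 0

/-! ### The Hardy space of the annulus in `ℂ` and its component spaces -/

/-- The open annulus `a < |z| < b` in `ℂ`. -/
def annulus (a b : ℝ) : TopologicalSpace.Opens ℂ where
  carrier := {z | a < ‖z‖ ∧ ‖z‖ < b}
  is_open' := (isOpen_lt continuous_const continuous_norm).inter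
    (isOpen_lt continuous_norm continuous_const)

/-- The mean value `M₂(f; r)`. -/
def meanTwo (f : ℂ → ℂ) (r : ℝ) : ℝ :=
  √(Real.circleAverage (fun z => ‖f z‖ ^ 2) 0 r)

/-- Membership in `H²` of the annulus (only the values of `f` on the annulus matter). -/
def MemH2 (a b : ℝ) (f : ℂ → ℂ) : Prop :=
  DifferentiableOn ℂ f (annulus a b) ∧ BddAbove (meanTwo f '' Ioo a b)

/-- The inner product of `H²` of the annulus, the sum of the limits at `r → a+` and `r → b-` of
`(1/2π) ∫ f(r e^{iφ}) conj (g(r e^{iφ})) dφ`. It is linear in `f`. -/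
def h2Inner (a b : ℝ) (f g : ℂ → ℂ) : ℂ :=
  limUnder (𝓝[>] a) (fun r => Real.circleAverage (fun z => f z * conj (g z)) 0 r) +
    limUnder (𝓝[<] b) (fun r => Real.circleAverage (fun z => f z * conj (g z)) 0 r)

/-- The norm of `H²` of the annulus. -/
def h2Norm (a b : ℝ) (f : ℂ → ℂ) : ℝ := √(h2Inner a b f f).re

/-- The space `V_{k,d}`, the linear span of the powers `z^{k+2j}` and `z^{-d-k+2+2j}`, `j ≥ 0`. -/
def laurentSpan (d k : ℕ) : Submodule ℂ (ℂ → ℂ) :=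
  Submodule.span ℂ
    ((range fun (j : ℕ) (z : ℂ) => z ^ ((k : ℤ) + 2 * j)) ∪
      (range fun (j : ℕ) (z : ℂ) => z ^ (-(d : ℤ) - k + 2 + 2 * j)))

/-- Membership in the component space `H^{2,k}`, the closure of `V_{k,d}` in `H²`. -/
def MemH2Component (a b : ℝ) (d k : ℕ) (f : ℂ → ℂ) : Prop :=
  MemH2 a b f ∧ ∀ ε > 0, ∃ p ∈ laurentSpan d k, h2Norm a b (f - p) < ε

/-! ### The polyharmonic Hardy space -/

/-- The complexified annulus, all `(z, θ)` with `a < |z| < b` and `θ ∈ 𝕊^{d-1}`. -/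
abbrev ComplexifiedAnnulus (a b : ℝ) (d : ℕ) : Type := annulus a b × Sphere d

/-- Families `f_{k,ℓ} ∈ H^{2,k}` with `∑ L^{2k} ‖f_{k,ℓ}‖² < ∞`. -/
def IsHardyFamily (a b L : ℝ) {d : ℕ} (c : Index d → ℂ → ℂ) : Prop :=
  (∀ i, MemH2Component a b d i.1 (c i)) ∧
    Summable fun i => h2Norm a b (c i) ^ 2 * L ^ (2 * i.1)

/-- `f(z, θ) = ∑ f_{k,ℓ}(z) Y_{k,ℓ}(θ)` for a family `f_{k,ℓ} ∈ H^{2,k}` of finite norm. -/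
def HasHardyExpansion (a b L : ℝ) {d : ℕ} (Y : Index d → MvPolynomial (Fin d) ℝ)
    (f : ComplexifiedAnnulus a b d → ℂ) (c : Index d → ℂ → ℂ) : Prop :=
  IsHardyFamily a b L c ∧
    ∀ p : ComplexifiedAnnulus a b d, HasSum (fun i => c i p.1 * (onSphere (Y i) p.2 : ℂ)) (f p)

/-- The polyharmonic Hardy space, as a set of functions on the complexified annulus. -/
def hardySpace (a b L : ℝ) {d : ℕ} (Y : Index d → MvPolynomial (Fin d) ℝ) :
    Set (ComplexifiedAnnulus a b d → ℂ) :=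
  {f | ∃ c, HasHardyExpansion a b L Y f c}

/-- Completeness of a complex vector space for the norm of a given inner product. -/
def CompleteFor {V : Type*} [AddCommGroup V] [Module ℂ V]
    (ip : InnerProductSpace.Core ℂ V) : Prop :=
  letI : NormedAddCommGroup V := ip.toNormedAddCommGroup
  CompleteSpace V

/-- The norm of a given inner product. -/
def normOf {V : Type*} [AddCommGroup V] [Module ℂ V]
    (ip : InnerProductSpace.Core ℂ V) (v : V) : ℝ :=
  √(ip.inner v v).re

end PolyharmonicHardy

end

/-!
The polyharmonic Hardy space is identified with a space of square summable sequences, and each of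
its properties is read off from the coefficients.

*One variable.* By Cauchy's theorem and Parseval's formula on circles, a holomorphic function on the
annulus is in `H²` exactly if its Laurent coefficients `cₘ` satisfy
`∑ |cₘ|² (a ^ (2m) + b ^ (2m)) < ∞`, and dominated convergence shows that the limits in the inner
product exist and give `∑ cₘ conj(eₘ) (a ^ (2m) + b ^ (2m))` (`memH2_iff`, `hasSum_h2Inner`).
The closure `H^{2,k}` of the span of the admissible powers consists of the functions whose other
coefficients vanish (`MemH2Component.laurentCoeff_eq_zero`, `memH2Component_laurentSum`). The
Cauchy–Schwarz inequality bounds the point evaluations by `√(2 / min (1 - |z|/b) (|z|/a - 1))` times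
the norm (`norm_le_h2Norm`).

*Spherical harmonics.* Everything needed follows from integration by parts against a radial function
whose gradient is a radial multiple of `x`. It gives the orthogonality of harmonics of different
degrees (`integral_sphere_harmonic_mul`) and the mean value property in the form `p ⋆ φ = p` for a
harmonic polynomial `p` and a radial mollifier `φ` (`integral_evalAt_add_mul_kernel`). Together with
polar coordinates the latter bounds the reproducing kernel of the harmonics of degree `k` on the
ball of radius `ρ` by a multiple of `R ^ (2k)`, for any `R > ρ`. Hence there are constants `Dᵢ` that
dominate the basis on a ball of some radius `ρ > 1` and satisfy `∑ Dᵢ² L ^ (-2k) < ∞`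
(`IsHarmonicBasis.exists_bound`).

*The space.* With these bounds the expansions converge absolutely and locally uniformly, also for
`θ` in a neighbourhood of the sphere. Integration against the basis over the sphere recovers the
components, so the coefficients are unique (`HasHardyExpansion.integral_mul`), and the map
`synthesis` from the sequences to the functions is injective with the Hardy space as its range.
This yields the inner product, completeness, and the maximum principle. For smoothness, every term
`c(z) Y(x)` is reproduced by convolution with a product of radial mollifiers in `z` and in `x`, by
the two mean value properties; by uniform convergence the sum is also reproduced, and so it is
smooth (`IsHardyFamily.contDiffAt`).
-/

noncomputable section

namespace PolyharmonicHardy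

/-! ### Radial mollifiers -/

/-- A smooth function of `s = ‖x‖ ^ 2`, equal to `1` for `s ≤ 0` and to `0` for `s ≥ δ ^ 2`. -/
def cutoff (δ s : ℝ) : ℝ := Real.smoothTransition (1 - s / δ ^ 2)

/-- The radial mollifier `x ↦ kernel δ (‖x‖ ^ 2)`: it is nonnegative, smooth and supported in the
ball of radius `δ`, and `kernel δ (‖x‖ ^ 2) • x` is minus the gradient of `cutoff δ (‖x‖ ^ 2)`.
It is not normalized. -/
def kernel (δ s : ℝ) : ℝ := -2 * deriv (cutoff δ) s

lemma contDiff_cutoff (δ : ℝ) : ContDiff ℝ ∞ (cutoff δ) :=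
  Real.smoothTransition.contDiff.comp (contDiff_const.sub (contDiff_id.div_const _))

lemma contDiff_kernel (δ : ℝ) : ContDiff ℝ ∞ (kernel δ) :=
  contDiff_const.mul (contDiff_infty_iff_deriv.1 (contDiff_cutoff δ)).2

lemma cutoff_nonneg (δ s : ℝ) : 0 ≤ cutoff δ s := Real.smoothTransition.nonneg _

lemma cutoff_eq_zero {δ s : ℝ} (hδ : 0 < δ) (hs : δ ^ 2 ≤ s) : cutoff δ s = 0 := by
  apply Real.smoothTransition.zero_of_nonpos
  have : 1 ≤ s / δ ^ 2 := (one_le_div (by positivity)).2 hs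
  linarith

lemma cutoff_zero (δ : ℝ) : cutoff δ 0 = 1 := by simp [cutoff]

lemma kernel_nonneg (δ s : ℝ) : 0 ≤ kernel δ s := by
  have h : Antitone (cutoff δ) := fun s t hst => Real.smoothTransition.monotone (by
    have : s / δ ^ 2 ≤ t / δ ^ 2 := by gcongr
    linarith)
  have := h.deriv_nonpos (x := s)
  unfold kernel
  linarith

lemma kernel_eq_zero {δ s : ℝ} (hδ : 0 < δ) (hs : δ ^ 2 ≤ s) : kernel δ s = 0 := by
  have : IsLocalMin (cutoff δ) s := Filter.Eventually.of_forall fun t => by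
    rw [cutoff_eq_zero hδ hs]; exact cutoff_nonneg δ t
  simp [kernel, this.deriv_eq_zero]

lemma exists_kernel_pos {δ : ℝ} (hδ : 0 < δ) : ∃ s > 0, 0 < kernel δ s := by
  obtain ⟨s, hs, h⟩ := exists_deriv_eq_slope (cutoff δ) (a := 0) (b := δ ^ 2) (by positivity)
    (contDiff_cutoff δ).continuous.continuousOn
    ((contDiff_cutoff δ).differentiable (by simp)).differentiableOn
  refine ⟨s, hs.1, ?_⟩
  rw [kernel, h, cutoff_eq_zero hδ le_rfl, cutoff_zero]
  have : 0 < δ ^ 2 := by positivity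
  have : (0 - 1) / (δ ^ 2 - 0) < 0 := div_neg_of_neg_of_pos (by norm_num) (by simpa using this)
  linarith

lemma exists_kernel_le {δ : ℝ} (hδ : 0 < δ) : ∃ M > 0, ∀ s ≥ 0, kernel δ s ≤ M := by
  obtain ⟨M, hM⟩ := (isCompact_Icc (a := (0 : ℝ)) (b := δ ^ 2)).exists_bound_of_continuousOn
    (contDiff_kernel δ).continuous.continuousOn
  refine ⟨max M 1, by positivity, fun s hs => ?_⟩
  rcases le_total s (δ ^ 2) with h | h
  · exact (le_abs_self _).trans ((hM s ⟨hs, h⟩).trans (le_max_left _ _))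
  · rw [kernel_eq_zero hδ h]; positivity

lemma kernel_norm_eq_zero {V : Type*} [NormedAddCommGroup V] {δ : ℝ} (hδ : 0 < δ) {x : V}
    (hx : δ ≤ ‖x‖) : kernel δ (‖x‖ ^ 2) = 0 :=
  kernel_eq_zero hδ (by gcongr)

section Radial

variable {V : Type*} [NormedAddCommGroup V] [InnerProductSpace ℝ V]

lemma contDiff_kernel_norm (δ : ℝ) : ContDiff ℝ ∞ fun x : V => kernel δ (‖x‖ ^ 2) :=
  (contDiff_kernel δ).comp (contDiff_norm_sq ℝ)

lemma hasFDerivAt_cutoff_norm (δ : ℝ) (x : V) :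
    HasFDerivAt (fun x : V => cutoff δ (‖x‖ ^ 2)) (-kernel δ (‖x‖ ^ 2) • innerSL ℝ x) x := by
  have h1 := (hasFDerivAt_id (𝕜 := ℝ) x).norm_sq
  have h2 : HasDerivAt (cutoff δ) (deriv (cutoff δ) (‖id x‖ ^ 2)) (‖id x‖ ^ 2) :=
    ((contDiff_cutoff δ).differentiable (by simp) _).hasDerivAt
  convert! h2.comp_hasFDerivAt x h1 using 1
  ext v
  simp [kernel]
  ring

variable [FiniteDimensional ℝ V]

lemma hasCompactSupport_cutoff_norm {δ : ℝ} (hδ : 0 < δ) :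
    HasCompactSupport fun x : V => cutoff δ (‖x‖ ^ 2) :=
  HasCompactSupport.intro (isCompact_closedBall (0 : V) δ) fun x hx =>
    cutoff_eq_zero hδ (by
      have : δ < ‖x‖ := by simpa using hx
      gcongr)

lemma hasCompactSupport_kernel_norm {δ : ℝ} (hδ : 0 < δ) :
    HasCompactSupport fun x : V => kernel δ (‖x‖ ^ 2) :=
  HasCompactSupport.intro (isCompact_closedBall (0 : V) δ) fun x hx =>
    kernel_norm_eq_zero hδ (by
      have : δ < ‖x‖ := by simpa using hx
      exact this.le)

variable [MeasurableSpace V] [BorelSpace V]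

lemma integral_norm_pow_mul_kernel_pos [Nontrivial V] {δ : ℝ} (hδ : 0 < δ) (k : ℕ) :
    0 < ∫ x : V, ‖x‖ ^ k * kernel δ (‖x‖ ^ 2) := by
  obtain ⟨s, hs, hpos⟩ := exists_kernel_pos hδ
  obtain ⟨x, hx⟩ := exists_norm_eq V (Real.sqrt_nonneg s)
  refine Continuous.integral_pos_of_hasCompactSupport_nonneg_nonzero (x := x)
    ((continuous_norm.pow k).mul (contDiff_kernel_norm δ).continuous)
    (hasCompactSupport_kernel_norm hδ).mul_left
    (fun x => mul_nonneg (by positivity) (kernel_nonneg _ _)) ?_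
  have h1 : ‖x‖ ^ 2 = s := by rw [hx, Real.sq_sqrt hs.le]
  have h2 : 0 < ‖x‖ := by rw [hx]; positivity
  rw [h1]
  positivity

lemma integral_kernel_pos [Nontrivial V] {δ : ℝ} (hδ : 0 < δ) :
    0 < ∫ x : V, kernel δ (‖x‖ ^ 2) := by
  simpa using integral_norm_pow_mul_kernel_pos (V := V) hδ 0

/-- Integration by parts against the radial mollifier, with the cutoff as its potential. -/
lemma integral_inner_mul_kernel {δ : ℝ} (hδ : 0 < δ) {f : V → ℝ} (hf : ContDiff ℝ 1 f) (v : V) :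
    ∫ x, f x * (inner ℝ x v * kernel δ (‖x‖ ^ 2)) = ∫ x, fderiv ℝ f x v * cutoff δ (‖x‖ ^ 2) := by
  have hd : ∀ x : V, fderiv ℝ (fun x : V => cutoff δ (‖x‖ ^ 2)) x v =
      -(inner ℝ x v * kernel δ (‖x‖ ^ 2)) := fun x => by
    rw [(hasFDerivAt_cutoff_norm δ x).fderiv]
    simp; ring
  have hk := (contDiff_kernel_norm (V := V) δ).continuous
  have hc : Continuous fun x : V => cutoff δ (‖x‖ ^ 2) :=
    (contDiff_cutoff δ).continuous.comp (by fun_prop)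
  have hfd : Continuous fun x => fderiv ℝ f x v :=
    (hf.continuous_fderiv (by simp)).clm_apply continuous_const
  have key := integral_mul_fderiv_eq_neg_fderiv_mul_of_integrable (μ := (volume : Measure V))
    (f := f) (g := fun x : V => cutoff δ (‖x‖ ^ 2)) (v := v)
    ((hfd.mul hc).integrable_of_hasCompactSupport (hasCompactSupport_cutoff_norm hδ).mul_left)
    (by
      simp_rw [hd]
      exact ((hf.continuous.mul ((continuous_id.inner continuous_const).mul
        hk).neg)).integrable_of_hasCompactSupport
          (hasCompactSupport_kernel_norm hδ).mul_left.neg.mul_left)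
    ((hf.continuous.mul hc).integrable_of_hasCompactSupport
      (hasCompactSupport_cutoff_norm hδ).mul_left)
    (fun x _ => hf.differentiable (by simp) x)
    (fun x _ => (hasFDerivAt_cutoff_norm δ x).differentiableAt)
  simp_rw [hd, mul_neg, integral_neg] at key
  exact neg_injective key

end Radial

/-! ### Harmonic polynomials as functions on Euclidean space -/

/-- The value of a real polynomial at a point of Euclidean space. -/
def evalAt {d : ℕ} (p : MvPolynomial (Fin d) ℝ) (x : EuclideanSpace ℝ (Fin d)) : ℝ :=
  MvPolynomial.eval (fun i => x i) p

/-- The Laplacian of a real polynomial. -/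
def laplacian {d : ℕ} (p : MvPolynomial (Fin d) ℝ) : MvPolynomial (Fin d) ℝ :=
  ∑ i, MvPolynomial.pderiv i (MvPolynomial.pderiv i p)

section Polynomials

variable {d : ℕ}

local notation "𝔼" => EuclideanSpace ℝ (Fin d)

lemma evalAt_mul (p q : MvPolynomial (Fin d) ℝ) (x : 𝔼) :
    evalAt (p * q) x = evalAt p x * evalAt q x := map_mul _ _ _

lemma evalAt_sub (p q : MvPolynomial (Fin d) ℝ) (x : 𝔼) :
    evalAt (p - q) x = evalAt p x - evalAt q x := map_sub _ _ _

lemma evalAt_sum {ι : Type*} (s : Finset ι) (p : ι → MvPolynomial (Fin d) ℝ) (x : 𝔼) :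
    evalAt (∑ i ∈ s, p i) x = ∑ i ∈ s, evalAt (p i) x := map_sum _ _ _

lemma hasFDerivAt_evalAt (p : MvPolynomial (Fin d) ℝ) (x : 𝔼) :
    HasFDerivAt (evalAt p)
      (∑ i, evalAt (MvPolynomial.pderiv i p) x • (EuclideanSpace.proj i : 𝔼 →L[ℝ] ℝ)) x := by
  induction p using MvPolynomial.induction_on with
  | C a =>
    have : evalAt (MvPolynomial.C a : MvPolynomial (Fin d) ℝ) = fun _ => a := by
      ext x; simp [evalAt]
    rw [this]
    simpa [evalAt] using hasFDerivAt_const a x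
  | add p q hp hq =>
    have : evalAt (p + q) = fun x : 𝔼 => evalAt p x + evalAt q x := by ext x; simp [evalAt]
    rw [this]
    convert! hp.add hq using 1
    simp [evalAt, add_smul, Finset.sum_add_distrib]
  | mul_X p j hp =>
    have : evalAt (p * MvPolynomial.X j) = fun x : 𝔼 => evalAt p x * x j := by
      ext x; simp [evalAt]
    rw [this]
    have hX : HasFDerivAt (fun x : 𝔼 => x j) (EuclideanSpace.proj j : 𝔼 →L[ℝ] ℝ) x :=
      (EuclideanSpace.proj j : 𝔼 →L[ℝ] ℝ).hasFDerivAt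
    convert! hp.mul hX using 1
    ext v
    simp [evalAt, MvPolynomial.pderiv_X, Pi.single_apply, add_mul, Finset.sum_add_distrib,
      Finset.mul_sum, apply_ite]
    refine Finset.sum_congr rfl fun i _ => by ring

lemma contDiff_evalAt (p : MvPolynomial (Fin d) ℝ) : ContDiff ℝ ∞ (evalAt p) := by
  induction p using MvPolynomial.induction_on with
  | C a =>
    have : evalAt (MvPolynomial.C a : MvPolynomial (Fin d) ℝ) = fun _ => a := by
      ext x; simp [evalAt]
    rw [this]
    exact contDiff_const
  | add p q hp hq =>
    have : evalAt (p + q) = fun x : 𝔼 => evalAt p x + evalAt q x := by ext x; simp [evalAt]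
    rw [this]
    exact hp.add hq
  | mul_X p j hp =>
    have hX : ContDiff ℝ ∞ (fun x : 𝔼 => x j) := (EuclideanSpace.proj j : 𝔼 →L[ℝ] ℝ).contDiff
    have : evalAt (p * MvPolynomial.X j) = fun x : 𝔼 => evalAt p x * x j := by
      ext x; simp [evalAt]
    rw [this]
    exact hp.mul hX

lemma continuous_evalAt (p : MvPolynomial (Fin d) ℝ) : Continuous (evalAt p) :=
  (contDiff_evalAt p).continuous

lemma fderiv_evalAt_single (p : MvPolynomial (Fin d) ℝ) (x : 𝔼) (i : Fin d) :
    fderiv ℝ (evalAt p) x (EuclideanSpace.single i 1) = evalAt (MvPolynomial.pderiv i p) x := by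
  rw [(hasFDerivAt_evalAt p x).fderiv]
  simp

lemma evalAt_smul {p : MvPolynomial (Fin d) ℝ} {k : ℕ} (hp : p.IsHomogeneous k) (r : ℝ) (x : 𝔼) :
    evalAt p (r • x) = r ^ k * evalAt p x := by
  unfold evalAt
  rw [MvPolynomial.eval_eq, MvPolynomial.eval_eq, Finset.mul_sum]
  refine Finset.sum_congr rfl fun m hm => ?_
  have : ∑ i ∈ m.support, m i = k := by
    exact (hp.coeff_eq_zero (d := m)).mt (by simpa using hm) |> not_not.1
  simp [mul_pow, Finset.prod_mul_distrib, Finset.prod_pow_eq_pow_sum, this]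
  ring

lemma evalAt_euler {p : MvPolynomial (Fin d) ℝ} {k : ℕ} (hp : p.IsHomogeneous k) (x : 𝔼) :
    ∑ i, x i * evalAt (MvPolynomial.pderiv i p) x = k * evalAt p x := by
  have := congr_arg (fun q => evalAt q x) hp.sum_X_mul_pderiv
  simpa [evalAt, map_sum] using this

lemma integral_coord_mul_kernel {δ : ℝ} (hδ : 0 < δ) {f : 𝔼 → ℝ} (hf : ContDiff ℝ 1 f)
    (i : Fin d) :
    ∫ x, f x * (x i * kernel δ (‖x‖ ^ 2)) =
      ∫ x, fderiv ℝ f x (EuclideanSpace.single i 1) * cutoff δ (‖x‖ ^ 2) := by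
  rw [← integral_inner_mul_kernel hδ hf]
  simp [EuclideanSpace.inner_single_right]

lemma continuous_cutoff_norm (δ : ℝ) : Continuous fun x : 𝔼 => cutoff δ (‖x‖ ^ 2) :=
  (contDiff_cutoff δ).continuous.comp (by fun_prop)

lemma continuous_kernel_norm (δ : ℝ) : Continuous fun x : 𝔼 => kernel δ (‖x‖ ^ 2) :=
  (contDiff_kernel_norm δ).continuous

/-- Green's identity for the field `q ∇p - p ∇q`, combined with Euler's identity. -/
lemma integral_harmonic_mul_kernel {δ : ℝ} (hδ : 0 < δ) {p q : MvPolynomial (Fin d) ℝ} {k j : ℕ}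
    (hp : p.IsHomogeneous k) (hq : q.IsHomogeneous j) (hp0 : laplacian p = 0)
    (hq0 : laplacian q = 0) (hkj : k ≠ j) :
    ∫ x, evalAt p x * evalAt q x * kernel δ (‖x‖ ^ 2) = 0 := by
  set F : Fin d → MvPolynomial (Fin d) ℝ := fun i =>
    MvPolynomial.pderiv i p * q - p * MvPolynomial.pderiv i q with hF
  have hk := continuous_kernel_norm (d := d) δ
  have hc := continuous_cutoff_norm (d := d) δ
  have h1 : ∑ i, ∫ x : 𝔼, evalAt (F i) x * (x i * kernel δ (‖x‖ ^ 2)) = 0 := by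
    simp_rw [integral_coord_mul_kernel hδ ((contDiff_evalAt _).of_le (by simp)),
      fderiv_evalAt_single]
    rw [← integral_finsetSum]
    · have h0 : ∑ i, MvPolynomial.pderiv i (F i) = 0 := by
        have : ∑ i, MvPolynomial.pderiv i (F i) = laplacian p * q - p * laplacian q := by
          simp only [laplacian, Finset.sum_mul, Finset.mul_sum, ← Finset.sum_sub_distrib]
          refine Finset.sum_congr rfl fun i _ => ?_
          simp [hF, Derivation.leibniz]
          ring
        rw [this, hp0, hq0]; simp
      simp_rw [← Finset.sum_mul, ← evalAt_sum, h0]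
      simp [evalAt]
    · exact fun i _ => ((continuous_evalAt _).mul hc).integrable_of_hasCompactSupport
        (hasCompactSupport_cutoff_norm hδ).mul_left
  rw [← integral_finsetSum] at h1
  · have h2 : ∀ x : 𝔼, ∑ i, evalAt (F i) x * (x i * kernel δ (‖x‖ ^ 2)) =
        ((k : ℝ) - j) * (evalAt p x * evalAt q x * kernel δ (‖x‖ ^ 2)) := fun x => by
      have e1 := evalAt_euler hp x
      have e2 := evalAt_euler hq x
      calc _ = ((∑ i, x i * evalAt (MvPolynomial.pderiv i p) x) * evalAt q x
            - evalAt p x * ∑ i, x i * evalAt (MvPolynomial.pderiv i q) x) *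
              kernel δ (‖x‖ ^ 2) := by
            rw [Finset.sum_mul, Finset.mul_sum, ← Finset.sum_sub_distrib, Finset.sum_mul]
            refine Finset.sum_congr rfl fun i _ => ?_
            simp only [hF, evalAt_sub, evalAt_mul]
            ring
        _ = _ := by rw [e1, e2]; ring
    simp_rw [h2, integral_const_mul] at h1
    refine (mul_eq_zero.1 h1).resolve_left ?_
    exact sub_ne_zero.2 (by exact_mod_cast hkj)
  · intro i _
    exact ((continuous_evalAt _).mul (Continuous.mul (by fun_prop)
      hk)).integrable_of_hasCompactSupport
      (hasCompactSupport_kernel_norm hδ).mul_left.mul_left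

lemma hasDerivAt_evalAt_line (q : MvPolynomial (Fin d) ℝ) (x y : 𝔼) (t : ℝ) :
    HasDerivAt (fun t : ℝ => evalAt q (x + t • y))
      (∑ i, evalAt (MvPolynomial.pderiv i q) (x + t • y) * y i) t := by
  have h1 : HasDerivAt (fun t : ℝ => x + t • y) y t := by
    simpa using ((hasDerivAt_id t).smul_const y).const_add x
  have := (hasFDerivAt_evalAt q (x + t • y)).comp_hasDerivAt t h1
  convert! this using 1
  simp

/-- The mean value property of a harmonic polynomial, averaged over all spheres around `x` with
the weight of the mollifier: the mollified values at scale `t` do not depend on `t`. -/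
lemma integral_evalAt_add_mul_kernel {δ : ℝ} (hδ : 0 < δ) {q : MvPolynomial (Fin d) ℝ}
    (hq : laplacian q = 0) (x : 𝔼) :
    ∫ y, evalAt q (x + y) * kernel δ (‖y‖ ^ 2) =
      evalAt q x * ∫ y : 𝔼, kernel δ (‖y‖ ^ 2) := by
  have hk := continuous_kernel_norm (d := d) δ
  set F' : ℝ → 𝔼 → ℝ := fun t y =>
    (∑ i, evalAt (MvPolynomial.pderiv i q) (x + t • y) * y i) * kernel δ (‖y‖ ^ 2)
  set G : ℝ → ℝ := fun t => ∫ y, evalAt q (x + t • y) * kernel δ (‖y‖ ^ 2)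
  have hint : ∀ t, ∫ y, F' t y = 0 := fun t => by
    have hsm : ∀ i, ContDiff ℝ 1 fun y : 𝔼 => evalAt (MvPolynomial.pderiv i q) (x + t • y) :=
      fun i => ((contDiff_evalAt _).of_le (by simp)).comp
        (contDiff_const.add (contDiff_id.const_smul t))
    have hd : ∀ i (y : 𝔼), fderiv ℝ (fun y : 𝔼 => evalAt (MvPolynomial.pderiv i q) (x + t • y)) y
        (EuclideanSpace.single i 1) =
          t * evalAt (MvPolynomial.pderiv i (MvPolynomial.pderiv i q)) (x + t • y) := by
      intro i y
      have h1 : HasFDerivAt (fun y : 𝔼 => x + t • y) (t • ContinuousLinearMap.id ℝ 𝔼) y :=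
        ((hasFDerivAt_id y).const_smul t).const_add x
      have h2 := (hasFDerivAt_evalAt (MvPolynomial.pderiv i q) (x + t • y)).comp y h1
      have h3 := h2.fderiv
      simp only [Function.comp_def] at h3
      rw [h3]
      simp
    calc ∫ y, F' t y
        = ∫ y : 𝔼, ∑ i, evalAt (MvPolynomial.pderiv i q) (x + t • y) *
            (y i * kernel δ (‖y‖ ^ 2)) := by
          congr 1; ext y
          simp only [F', Finset.sum_mul, mul_assoc]
      _ = ∑ i, ∫ y : 𝔼, evalAt (MvPolynomial.pderiv i q) (x + t • y) *
            (y i * kernel δ (‖y‖ ^ 2)) := by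
          refine integral_finsetSum _ fun i _ => ?_
          exact ((hsm i).continuous.mul (Continuous.mul (by fun_prop)
            hk)).integrable_of_hasCompactSupport
            (hasCompactSupport_kernel_norm hδ).mul_left.mul_left
      _ = ∑ i, ∫ y : 𝔼, t * evalAt (MvPolynomial.pderiv i (MvPolynomial.pderiv i q)) (x + t • y) *
            cutoff δ (‖y‖ ^ 2) := by
          refine Finset.sum_congr rfl fun i _ => ?_
          rw [integral_coord_mul_kernel hδ (hsm i)]
          simp_rw [hd]
      _ = ∫ y : 𝔼, ∑ i, t * evalAt (MvPolynomial.pderiv i (MvPolynomial.pderiv i q)) (x + t • y) *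
            cutoff δ (‖y‖ ^ 2) := by
          refine (integral_finsetSum _ fun i _ => ?_).symm
          refine Continuous.integrable_of_hasCompactSupport (Continuous.mul
            (continuous_const.mul ((continuous_evalAt _).comp (by fun_prop)))
            (continuous_cutoff_norm δ)) (hasCompactSupport_cutoff_norm hδ).mul_left
      _ = 0 := by
          simp_rw [← Finset.sum_mul, ← Finset.mul_sum, ← evalAt_sum]
          have : ∑ i, MvPolynomial.pderiv i (MvPolynomial.pderiv i q) = 0 := hq
          rw [this]
          simp [evalAt]
  have hG : ∀ t, HasDerivAt G 0 t := fun t₀ => by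
    have hjoint : Continuous fun z : ℝ × 𝔼 =>
        ∑ i, evalAt (MvPolynomial.pderiv i q) (x + z.1 • z.2) * z.2 i :=
      continuous_finsetSum _ fun i _ =>
        ((continuous_evalAt _).comp (by fun_prop)).mul (by fun_prop)
    obtain ⟨M, hM⟩ := ((isCompact_Icc (a := t₀ - 1) (b := t₀ + 1)).prod
      (isCompact_closedBall (0 : 𝔼) δ)).exists_bound_of_continuousOn hjoint.continuousOn
    have hFi : ∀ t : ℝ, Continuous fun y : 𝔼 => evalAt q (x + t • y) * kernel δ (‖y‖ ^ 2) :=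
      fun t => ((continuous_evalAt _).comp (by fun_prop)).mul hk
    have hF'i : Continuous (F' t₀) :=
      (continuous_finsetSum _ fun i _ =>
        ((continuous_evalAt _).comp (by fun_prop)).mul (by fun_prop)).mul hk
    have := (hasDerivAt_integral_of_dominated_loc_of_deriv_le (μ := (volume : Measure 𝔼))
      (F := fun t y => evalAt q (x + t • y) * kernel δ (‖y‖ ^ 2)) (F' := F') (x₀ := t₀)
      (bound := fun y => M * kernel δ (‖y‖ ^ 2)) (s := Icc (t₀ - 1) (t₀ + 1))
      (Icc_mem_nhds (by linarith) (by linarith))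
      (Eventually.of_forall fun t => (hFi t).aestronglyMeasurable)
      ((hFi t₀).integrable_of_hasCompactSupport (hasCompactSupport_kernel_norm hδ).mul_left)
      hF'i.aestronglyMeasurable
      (Eventually.of_forall fun y t ht => ?_)
      ((continuous_const.mul hk).integrable_of_hasCompactSupport
        (hasCompactSupport_kernel_norm hδ).mul_left)
      (Eventually.of_forall fun y t _ => (hasDerivAt_evalAt_line q x y t).mul_const _)).2
    · rwa [hint t₀] at this
    · rcases le_total δ ‖y‖ with h | h
      · simp [F', kernel_norm_eq_zero hδ h]
      · simp only [F', norm_mul]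
        rw [Real.norm_of_nonneg (kernel_nonneg _ _)]
        exact mul_le_mul_of_nonneg_right (hM (t, y) ⟨ht, by simpa using h⟩) (kernel_nonneg _ _)
  have := is_const_of_deriv_eq_zero (fun t => (hG t).differentiableAt) (fun t => (hG t).deriv) 1 0
  simpa [G, integral_const_mul] using this

end Polynomials

/-! ### Integration in polar coordinates -/

section Polar

variable {V : Type*} [NormedAddCommGroup V] [NormedSpace ℝ V] [FiniteDimensional ℝ V]
  [Nontrivial V] [MeasurableSpace V] [BorelSpace V] (μ : Measure V) [μ.IsAddHaarMeasure]

/-- Polar coordinates for a homogeneous function of degree `K` times a radial weight. -/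
lemma integral_homogeneous_mul_radial {P : V → ℝ} {K : ℕ}
    (hP : ∀ r > 0, ∀ x, P (r • x) = r ^ K * P x) (χ : ℝ → ℝ) :
    ∫ x, P x * χ ‖x‖ ∂μ =
      (∫ r : Ioi (0 : ℝ), (r : ℝ) ^ K * χ r ∂Measure.volumeIoiPow (Module.finrank ℝ V - 1)) *
        ∫ θ : Metric.sphere (0 : V) 1, P θ ∂μ.toSphere := by
  calc ∫ x, P x * χ ‖x‖ ∂μ
      = ∫ x : ({(0)}ᶜ : Set V), P x * χ ‖x.1‖ ∂μ.comap (↑) := by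
        rw [integral_subtype_comap (measurableSet_singleton _).compl fun x => P x * χ ‖x‖,
          restrict_compl_singleton]
    _ = ∫ x : Metric.sphere (0 : V) 1 × Ioi (0 : ℝ), P x.1 * ((x.2 : ℝ) ^ K * χ x.2)
          ∂μ.toSphere.prod (Measure.volumeIoiPow (Module.finrank ℝ V - 1)) := by
        rw [← μ.measurePreserving_homeomorphUnitSphereProd.integral_comp
          (Homeomorph.measurableEmbedding _)]
        congr 1
        ext x
        have hx : 0 < ‖(x : V)‖ := norm_pos_iff.2 x.2
        have h := hP ‖(x : V)‖ hx (‖(x : V)‖⁻¹ • (x : V))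
        rw [smul_smul, mul_inv_cancel₀ hx.ne', one_smul] at h
        simp only [homeomorphUnitSphereProd_apply_fst_coe, homeomorphUnitSphereProd_apply_snd_coe]
        rw [h]
        ring
    _ = _ := by
        rw [integral_prod_mul (fun θ : Metric.sphere (0 : V) 1 => P θ)
          (fun r : Ioi (0 : ℝ) => (r : ℝ) ^ K * χ r), mul_comm]

end Polar

/-! ### Orthogonality and growth of the harmonic basis -/

section Basis

variable {n : ℕ}

local notation "𝔼" => EuclideanSpace ℝ (Fin (n + 1))

/-- The surface measure of the unit sphere. -/
abbrev surface (n : ℕ) : Measure (Sphere (n + 1)) :=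
  (volume : Measure (EuclideanSpace ℝ (Fin (n + 1)))).toSphere

lemma continuous_onSphere (p : MvPolynomial (Fin (n + 1)) ℝ) : Continuous (onSphere p) :=
  (continuous_evalAt p).comp continuous_subtype_val

lemma integrable_of_continuous_sphere {F : Type*} [NormedAddCommGroup F]
    {f : Sphere (n + 1) → F} (hf : Continuous f) : Integrable f (surface n) :=
  hf.integrable_of_hasCompactSupport (HasCompactSupport.of_compactSpace f)

/-- Homogeneous harmonic polynomials of different degrees are orthogonal on the sphere. -/
lemma integral_sphere_harmonic_mul {p q : MvPolynomial (Fin (n + 1)) ℝ} {k j : ℕ}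
    (hp : p.IsHomogeneous k) (hq : q.IsHomogeneous j) (hp0 : laplacian p = 0)
    (hq0 : laplacian q = 0) (hkj : k ≠ j) :
    ∫ θ, onSphere p θ * onSphere q θ ∂surface n = 0 := by
  have h1 := integral_harmonic_mul_kernel one_pos hp hq hp0 hq0 hkj
  have h2 := integral_homogeneous_mul_radial (volume : Measure 𝔼) (K := k + j)
    (P := fun x => evalAt p x * evalAt q x)
    (fun r _ x => by simp only [evalAt_smul hp, evalAt_smul hq]; ring)
    (fun r => kernel 1 (r ^ 2))
  have h3 := integral_homogeneous_mul_radial (volume : Measure 𝔼) (K := k + j)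
    (P := fun x => ‖x‖ ^ (k + j)) (fun r hr x => by
      rw [norm_smul, Real.norm_of_nonneg hr.le, mul_pow]) (fun r => kernel 1 (r ^ 2))
  rw [h1] at h2
  have h4 := integral_norm_pow_mul_kernel_pos (V := 𝔼) one_pos (k + j)
  refine (mul_eq_zero.1 h2.symm).resolve_left fun h0 => ?_
  rw [h3, h0, zero_mul] at h4
  exact lt_irrefl _ h4

/-- A homogeneous harmonic polynomial of degree `k` is bounded on the ball of radius `ρ` by
`R ^ k` times its `L²` norm on the sphere, for every `R > ρ`: average the square of the polynomial
over balls of radius `R - ρ` and use polar coordinates. -/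
lemma exists_sq_evalAt_le {ρ R : ℝ} (hρR : ρ < R) :
    ∃ C > 0, ∀ (k : ℕ) (p : MvPolynomial (Fin (n + 1)) ℝ), p.IsHomogeneous k → laplacian p = 0 →
      ∀ x : 𝔼, ‖x‖ ≤ ρ →
        evalAt p x ^ 2 ≤ C * R ^ (2 * k) * ∫ θ, onSphere p θ ^ 2 ∂surface n := by
  obtain ⟨δ, hδ'⟩ : ∃ δ, δ = R - ρ := ⟨_, rfl⟩
  have hδ : 0 < δ := hδ' ▸ sub_pos.2 hρR
  obtain ⟨M, hM0, hM⟩ := exists_kernel_le hδ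
  obtain ⟨A, hA'⟩ : ∃ A, A = ∫ y : 𝔼, kernel δ (‖y‖ ^ 2) := ⟨_, rfl⟩
  have hA : 0 < A := hA' ▸ integral_kernel_pos hδ
  set χ : ℝ → ℝ := (Iio R).indicator 1
  set ν := Measure.volumeIoiPow (Module.finrank ℝ 𝔼 - 1)
  set B := ∫ r : Ioi (0 : ℝ), χ r ∂ν
  refine ⟨M / A * (|B| + 1), by positivity, fun k p hp hp0 x hx => ?_⟩
  have hR : 0 < R := ((norm_nonneg x).trans hx).trans_lt hρR
  set S := ∫ θ, onSphere p θ ^ 2 ∂surface n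
  have hS : 0 ≤ S := integral_nonneg fun _ => sq_nonneg _
  have hk := continuous_kernel_norm (d := n + 1) δ
  have hcs : HasCompactSupport fun y : 𝔼 => kernel δ (‖y‖ ^ 2) := hasCompactSupport_kernel_norm hδ
  have hpc := continuous_evalAt p
  have i1 : Integrable fun y : 𝔼 => evalAt p (x + y) ^ 2 * kernel δ (‖y‖ ^ 2) :=
    (Continuous.mul (by fun_prop) hk).integrable_of_hasCompactSupport hcs.mul_left
  have i2 : Integrable fun y : 𝔼 => evalAt p (x + y) * kernel δ (‖y‖ ^ 2) :=
    (Continuous.mul (by fun_prop) hk).integrable_of_hasCompactSupport hcs.mul_left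
  have i3 : Integrable fun y : 𝔼 => kernel δ (‖y‖ ^ 2) := hk.integrable_of_hasCompactSupport hcs
  -- Jensen's inequality, from the variance of `p` around its mean `p x`
  have h1 : evalAt p x ^ 2 * A ≤ ∫ y : 𝔼, evalAt p (x + y) ^ 2 * kernel δ (‖y‖ ^ 2) := by
    have h0 : 0 ≤ ∫ y : 𝔼, (evalAt p (x + y) - evalAt p x) ^ 2 * kernel δ (‖y‖ ^ 2) :=
      integral_nonneg fun y => mul_nonneg (sq_nonneg _) (kernel_nonneg _ _)
    have h2 : ∫ y : 𝔼, (evalAt p (x + y) - evalAt p x) ^ 2 * kernel δ (‖y‖ ^ 2) =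
        (∫ y : 𝔼, evalAt p (x + y) ^ 2 * kernel δ (‖y‖ ^ 2))
          - 2 * evalAt p x * (∫ y : 𝔼, evalAt p (x + y) * kernel δ (‖y‖ ^ 2))
          + evalAt p x ^ 2 * A := by
      have i4 : Integrable fun y : 𝔼 => evalAt p (x + y) ^ 2 * kernel δ (‖y‖ ^ 2)
          - 2 * evalAt p x * (evalAt p (x + y) * kernel δ (‖y‖ ^ 2)) := i1.sub (i2.const_mul _)
      rw [hA', ← integral_const_mul, ← integral_const_mul, ← integral_sub i1 (i2.const_mul _),
        ← integral_add i4 (i3.const_mul _)]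
      congr 1; ext y
      ring
    rw [h2, integral_evalAt_add_mul_kernel hδ hp0, ← hA'] at h0
    nlinarith
  have h2 : ∫ y : 𝔼, evalAt p (x + y) ^ 2 * kernel δ (‖y‖ ^ 2) ≤
      ∫ y : 𝔼, M * (evalAt p y ^ 2 * χ ‖y‖) := by
    have : ∫ y : 𝔼, evalAt p (x + y) ^ 2 * kernel δ (‖y‖ ^ 2) =
        ∫ y : 𝔼, evalAt p y ^ 2 * kernel δ (‖y - x‖ ^ 2) := by
      rw [← integral_add_left_eq_self (fun y : 𝔼 => evalAt p y ^ 2 * kernel δ (‖y - x‖ ^ 2)) x]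
      simp
    rw [this]
    refine integral_mono_of_nonneg
      (Eventually.of_forall fun y => mul_nonneg (sq_nonneg _) (kernel_nonneg _ _)) ?_
      (Eventually.of_forall fun y => ?_)
    · have : (fun y : 𝔼 => M * (evalAt p y ^ 2 * χ ‖y‖)) =
          (Metric.ball (0 : 𝔼) R).indicator fun y => M * evalAt p y ^ 2 := by
        ext y
        by_cases hy : ‖y‖ < R <;> simp [χ, indicator, hy]
      rw [this, integrable_indicator_iff Metric.isOpen_ball.measurableSet]
      exact ((continuous_const.mul (hpc.pow 2)).continuousOn.integrableOn_compact
        (isCompact_closedBall (0 : 𝔼) R)).mono_set Metric.ball_subset_closedBall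
    · dsimp only
      rcases lt_or_ge ‖y - x‖ δ with h | h
      · have hy : ‖y‖ < R := by
          have := norm_add_le (y - x) x
          rw [sub_add_cancel] at this
          linarith
        have : χ ‖y‖ = 1 := by simp [χ, hy]
        rw [this, mul_one, mul_comm]
        exact mul_le_mul_of_nonneg_right (hM _ (by positivity)) (sq_nonneg _)
      · rw [kernel_norm_eq_zero hδ h, mul_zero]
        have : 0 ≤ χ ‖y‖ := indicator_nonneg (fun _ _ => zero_le_one) _
        positivity
  have h3 : ∫ y : 𝔼, evalAt p y ^ 2 * χ ‖y‖ =
      (∫ r : Ioi (0 : ℝ), (r : ℝ) ^ (2 * k) * χ r ∂ν) * S :=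
    integral_homogeneous_mul_radial (volume : Measure 𝔼) (K := 2 * k)
      (P := fun x => evalAt p x ^ 2)
      (fun r _ x => by simp only [evalAt_smul hp]; ring) χ
  have hiχ : Integrable (fun r : Ioi (0 : ℝ) => χ r) ν := by
    have : (fun r : Ioi (0 : ℝ) => χ r) = (Iio (⟨R, hR⟩ : Ioi (0 : ℝ))).indicator 1 := by
      ext r
      by_cases hr : (r : ℝ) < R
      · have : r < ⟨R, hR⟩ := hr
        simp [χ, hr, this]
      · have : ¬ r < ⟨R, hR⟩ := hr
        simp [χ, hr, this]
    rw [this]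
    refine (integrable_indicator_iff measurableSet_Iio).2 ?_
    refine integrableOn_const (by simp [ν, Measure.volumeIoiPow_apply_Iio])
  have h4 : ∫ r : Ioi (0 : ℝ), (r : ℝ) ^ (2 * k) * χ r ∂ν ≤ R ^ (2 * k) * B := by
    rw [← integral_const_mul]
    refine integral_mono_of_nonneg (Eventually.of_forall fun r => ?_) (hiχ.const_mul _)
      (Eventually.of_forall fun r => ?_)
    · have : 0 ≤ χ r := indicator_nonneg (fun _ _ => zero_le_one) _
      have hr : (0 : ℝ) < r := r.2
      positivity
    · dsimp only
      by_cases hr : (r : ℝ) < R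
      · have hr0 : (0 : ℝ) < r := r.2
        simp only [χ, indicator, mem_Iio, hr, if_true, Pi.one_apply, mul_one]
        gcongr
      · simp [χ, hr]
  rw [integral_const_mul, h3] at h2
  have h5 : evalAt p x ^ 2 * A ≤ M * (R ^ (2 * k) * (|B| + 1) * S) := by
    refine h1.trans (h2.trans ?_)
    have : B ≤ |B| + 1 := by linarith [le_abs_self B]
    gcongr
    exact h4.trans (by gcongr)
  calc evalAt p x ^ 2 ≤ M * (R ^ (2 * k) * (|B| + 1) * S) / A := (le_div_iff₀ hA).2 h5
    _ = _ := by ring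

variable {Y : Index (n + 1) → MvPolynomial (Fin (n + 1)) ℝ}

lemma IsHarmonicBasis.map_mem (hY : IsHarmonicBasis Y) (i : Index (n + 1)) :
    MvPolynomial.map (algebraMap ℝ ℂ) (Y i) ∈ solidHarmonics (n + 1) i.1 := by
  rw [← hY.span_eq]
  exact Submodule.subset_span ⟨i.2, rfl⟩

lemma IsHarmonicBasis.isHomogeneous (hY : IsHarmonicBasis Y) (i : Index (n + 1)) :
    (Y i).IsHomogeneous i.1 := by
  have h := (Submodule.mem_inf.1 (hY.map_mem i)).1
  rw [MvPolynomial.mem_homogeneousSubmodule] at h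
  exact MvPolynomial.IsHomogeneous.of_map (algebraMap ℝ ℂ).injective h

lemma IsHarmonicBasis.laplacian_eq (hY : IsHarmonicBasis Y) (i : Index (n + 1)) :
    laplacian (Y i) = 0 := by
  have h := (Submodule.mem_inf.1 (hY.map_mem i)).2
  apply MvPolynomial.map_injective _ (algebraMap ℝ ℂ).injective
  rw [map_zero, ← LinearMap.mem_ker.1 h]
  simp [laplacian, MvPolynomial.pderiv_map]

lemma IsHarmonicBasis.integral_mul (hY : IsHarmonicBasis Y) (i j : Index (n + 1)) :
    ∫ θ, onSphere (Y i) θ * onSphere (Y j) θ ∂surface n = if i = j then 1 else 0 := by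
  obtain ⟨k, l⟩ := i
  obtain ⟨k', l'⟩ := j
  by_cases h : k = k'
  · subst h
    rw [hY.orthonormal]
    simp
  · rw [integral_sphere_harmonic_mul (hY.isHomogeneous _) (hY.isHomogeneous _)
      (hY.laplacian_eq _) (hY.laplacian_eq _) h, if_neg]
    simp [h]

/-- The growth of the reproducing kernel of the harmonics of degree `k` on the ball of
radius `ρ`. The bound for one polynomial is applied to `∑ₗ Yₖₗ(x) Yₖₗ`. -/
lemma IsHarmonicBasis.exists_sum_sq_le (hY : IsHarmonicBasis Y) {ρ R : ℝ} (hρR : ρ < R)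
    (hR : 0 < R) :
    ∃ C > 0, ∀ (k : ℕ) (x : 𝔼), ‖x‖ ≤ ρ → ∑ l, evalAt (Y ⟨k, l⟩) x ^ 2 ≤ C * R ^ (2 * k) := by
  obtain ⟨C, hC, h⟩ := exists_sq_evalAt_le (n := n) hρR
  refine ⟨C, hC, fun k x hx => ?_⟩
  set s := ∑ l, evalAt (Y ⟨k, l⟩) x ^ 2
  have hs : 0 ≤ s := Finset.sum_nonneg fun _ _ => sq_nonneg _
  set p := ∑ l, MvPolynomial.C (evalAt (Y ⟨k, l⟩) x) * Y ⟨k, l⟩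
  have hp : p.IsHomogeneous k := MvPolynomial.IsHomogeneous.sum _ _ _ fun l _ => by
    simpa using (MvPolynomial.isHomogeneous_C _ _).mul (hY.isHomogeneous ⟨k, l⟩)
  have hp0 : laplacian p = 0 := by
    have h1 : ∀ l, ∑ i, MvPolynomial.pderiv i (MvPolynomial.pderiv i
        (MvPolynomial.C (evalAt (Y ⟨k, l⟩) x) * Y ⟨k, l⟩)) = 0 := fun l => by
      have h0 := hY.laplacian_eq ⟨k, l⟩
      unfold laplacian at h0
      simp only [Derivation.leibniz, MvPolynomial.pderiv_C, add_zero, smul_eq_mul,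
        ← Finset.mul_sum, h0, mul_zero]
    simp only [laplacian, p, map_sum]
    rw [Finset.sum_comm]
    exact Finset.sum_eq_zero fun l _ => h1 l
  have hpx : ∀ y : 𝔼, evalAt p y = ∑ l, evalAt (Y ⟨k, l⟩) x * evalAt (Y ⟨k, l⟩) y := fun y => by
    simp [p, evalAt]
  have hpi : ∫ θ, onSphere p θ ^ 2 ∂surface n = s := by
    have e : ∀ θ : Sphere (n + 1), onSphere p θ ^ 2 = ∑ l, ∑ m, evalAt (Y ⟨k, l⟩) x *
        evalAt (Y ⟨k, m⟩) x * (onSphere (Y ⟨k, l⟩) θ * onSphere (Y ⟨k, m⟩) θ) := fun θ => by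
      have : onSphere p θ = ∑ l, evalAt (Y ⟨k, l⟩) x * onSphere (Y ⟨k, l⟩) θ := hpx θ
      rw [this, sq, Finset.sum_mul_sum]
      refine Finset.sum_congr rfl fun l _ => Finset.sum_congr rfl fun m _ => by ring
    simp_rw [e]
    have hi : ∀ l m, Integrable (fun θ => evalAt (Y ⟨k, l⟩) x * evalAt (Y ⟨k, m⟩) x *
        (onSphere (Y ⟨k, l⟩) θ * onSphere (Y ⟨k, m⟩) θ)) (surface n) := fun l m =>
      integrable_of_continuous_sphere
        (continuous_const.mul ((continuous_onSphere _).mul (continuous_onSphere _)))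
    rw [integral_finsetSum _ fun l _ => integrable_finsetSum _ fun m _ => hi l m]
    simp_rw [integral_finsetSum _ fun m _ => hi _ m, integral_const_mul, hY.orthonormal]
    simp [s, sq]
  have key := h k p hp hp0 x hx
  rw [hpi, hpx] at key
  have hs2 : ∑ l, evalAt (Y ⟨k, l⟩) x * evalAt (Y ⟨k, l⟩) x = s := by simp [s, sq]
  rw [hs2] at key
  by_contra! hlt
  have : 0 < s := lt_of_le_of_lt (by positivity) hlt
  nlinarith

/-- The harmonic basis is dominated, on a ball slightly larger than the unit ball, by constants
that are square summable with the weight `L ^ (-2k)`. Integration of the reproducing kernel over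
the sphere bounds the dimension of the space of harmonics of degree `k`. -/
lemma IsHarmonicBasis.exists_bound (hY : IsHarmonicBasis Y) {L : ℝ} (hL : 1 < L) :
    ∃ ρ > 1, ∃ D : Index (n + 1) → ℝ, (∀ i, 0 ≤ D i) ∧
      (∀ i (x : 𝔼), ‖x‖ ≤ ρ → |evalAt (Y i) x| ≤ D i) ∧
      Summable fun i => D i ^ 2 / L ^ (2 * i.1) := by
  -- the reproducing kernel and the dimension both grow like `R ^ (2k)`, hence `R ^ 2 < L`
  obtain ⟨ρ, hρ1, hρL⟩ := exists_between
    (Real.lt_sqrt_of_sq_lt (x := 1) (by simpa using hL))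
  obtain ⟨R, hρR, hRL⟩ := exists_between hρL
  have hR : 0 < R := by linarith
  have hRL2 : R ^ 2 < L := (Real.lt_sqrt hR.le).1 hRL
  obtain ⟨C, hC, h⟩ := hY.exists_sum_sq_le hρR hR
  have hle : ∀ (i : Index (n + 1)) (x : 𝔼), ‖x‖ ≤ ρ → evalAt (Y i) x ^ 2 ≤ C * R ^ (2 * i.1) :=
    fun i x hx => (Finset.single_le_sum (f := fun l => evalAt (Y ⟨i.1, l⟩) x ^ 2)
      (fun _ _ => sq_nonneg _) (Finset.mem_univ i.2)).trans (h i.1 x hx)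
  set σ := (surface n).real univ
  have hdim : ∀ k, (Module.finrank ℂ (solidHarmonics (n + 1) k) : ℝ) ≤ C * R ^ (2 * k) * σ := by
    intro k
    have h1 : ∫ θ, ∑ l, onSphere (Y ⟨k, l⟩) θ ^ 2 ∂surface n ≤
        ∫ _ : Sphere (n + 1), C * R ^ (2 * k) ∂surface n := by
      refine integral_mono (integrable_of_continuous_sphere
        (continuous_finsetSum _ fun l _ => (continuous_onSphere _).pow 2))
        (integrable_of_continuous_sphere continuous_const) fun θ => h k θ ?_
      simpa using hρ1.le
    rw [integral_finsetSum _ fun l _ => integrable_of_continuous_sphere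
      (f := fun θ => onSphere (Y ⟨k, l⟩) θ ^ 2) ((continuous_onSphere _).pow 2)] at h1
    simp_rw [sq, hY.orthonormal] at h1
    simpa [σ, mul_comm] using h1
  refine ⟨ρ, hρ1, fun i => √(C * R ^ (2 * i.1)), fun i => Real.sqrt_nonneg _,
    fun i x hx => Real.abs_le_sqrt (hle i x hx), ?_⟩
  have hnn : ∀ i : Index (n + 1), 0 ≤ √(C * R ^ (2 * i.1)) ^ 2 / L ^ (2 * i.1) := fun i => by
    positivity
  rw [summable_sigma_of_nonneg hnn]
  refine ⟨fun k => Summable.of_finite, ?_⟩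
  have hq : (R ^ 2 / L) ^ 2 < 1 := by
    have h0 : 0 ≤ R ^ 2 / L := by positivity
    have h1 : R ^ 2 / L < 1 := (div_lt_one (by linarith)).2 hRL2
    nlinarith
  refine Summable.of_nonneg_of_le (fun k => tsum_nonneg fun l => hnn ⟨k, l⟩) (fun k => ?_)
    ((summable_geometric_of_lt_one (by positivity) hq).mul_left (C ^ 2 * σ))
  dsimp only
  rw [tsum_fintype, Finset.sum_const, Finset.card_univ, Fintype.card_fin, nsmul_eq_mul,
    Real.sq_sqrt (by positivity)]
  have hL0 : 0 < L := by linarith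
  calc _ ≤ (C * R ^ (2 * k) * σ) * (C * R ^ (2 * k) / L ^ (2 * k)) := by
        gcongr
        exact hdim k
    _ = _ := by
        have : L ^ (2 * k) = (L ^ 2) ^ k := by rw [pow_mul]
        rw [div_pow, div_pow, this, ← pow_mul, ← pow_mul, ← pow_mul]
        ring

end Basis

/-! ### The Cauchy–Schwarz inequality for series -/

lemma summable_mul_of_sq {ι : Type*} {f g : ι → ℝ} (hf : Summable fun i => f i ^ 2)
    (hg : Summable fun i => g i ^ 2) : Summable fun i => f i * g i :=
  ((hf.add hg).mul_left 2⁻¹).of_norm_bounded fun i => by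
    rw [Real.norm_eq_abs, abs_le]
    constructor <;> nlinarith [sq_nonneg (f i - g i), sq_nonneg (f i + g i)]

lemma tsum_mul_le_sqrt_mul_sqrt {ι : Type*} {f g : ι → ℝ} (hf : Summable fun i => f i ^ 2)
    (hg : Summable fun i => g i ^ 2) :
    ∑' i, f i * g i ≤ √(∑' i, f i ^ 2) * √(∑' i, g i ^ 2) := by
  refine (summable_mul_of_sq hf hg).tsum_le_of_sum_le fun s => ?_
  refine (Real.sum_mul_le_sqrt_mul_sqrt s f g).trans ?_
  gcongr
  · exact hf.sum_le_tsum s fun _ _ => sq_nonneg _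
  · exact hg.sum_le_tsum s fun _ _ => sq_nonneg _

/-! ### Fourier series on circles -/

local instance fact_two_pi_pos : Fact (0 < 2 * Real.pi) := ⟨Real.two_pi_pos⟩

lemma circleAverage_eq_integral_haar {F : Type*} [NormedAddCommGroup F] [NormedSpace ℝ F]
    (f : ℂ → F) (r : ℝ) :
    Real.circleAverage f 0 r =
      ∫ t : AddCircle (2 * Real.pi), f (r * AddCircle.toCircle t) ∂AddCircle.haarAddCircle := by
  have h := AddCircle.intervalIntegral_preimage (2 * Real.pi) 0
    fun t : AddCircle (2 * Real.pi) => f (r * AddCircle.toCircle t)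
  rw [AddCircle.volume_eq_smul_haarAddCircle, integral_smul_measure,
    ENNReal.toReal_ofReal Real.two_pi_pos.le, zero_add] at h
  rw [Real.circleAverage_def, ← inv_smul_eq_iff₀ Real.two_pi_pos.ne'] at *
  rw [← h]
  congr 2
  ext t
  rw [AddCircle.toCircle_apply_mk, div_self Real.two_pi_pos.ne', one_mul, Circle.coe_exp]
  simp [circleMap]

lemma continuous_coe_toCircle :
    Continuous fun t : AddCircle (2 * Real.pi) => (AddCircle.toCircle t : ℂ) :=
  continuous_subtype_val.comp AddCircle.continuous_toCircle

/-- The restriction of a function to the circle of radius `r`, on the additive circle. -/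
def onCircle (f : ℂ → ℂ) {r : ℝ} (hr : 0 < r) (hf : ContinuousOn f (Metric.sphere 0 r)) :
    C(AddCircle (2 * Real.pi), ℂ) where
  toFun t := f (r * AddCircle.toCircle t)
  continuous_toFun := hf.comp_continuous
    (continuous_const.mul continuous_coe_toCircle)
    fun t => by simp [Circle.norm_coe, hr.le]

lemma fourierCoeff_onCircle {f : ℂ → ℂ} {r : ℝ} (hr : 0 < r)
    (hf : ContinuousOn f (Metric.sphere 0 r)) (m : ℤ) :
    fourierCoeff (onCircle f hr hf) m =
      (r : ℂ) ^ m * Real.circleAverage (fun z => f z * z ^ (-m)) 0 r := by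
  rw [circleAverage_eq_integral_haar, fourierCoeff, ← integral_const_mul]
  congr 1
  ext t
  have hr' : (r : ℂ) ≠ 0 := by exact_mod_cast hr.ne'
  simp only [fourier_apply, AddCircle.toCircle_zsmul, onCircle, ContinuousMap.coe_mk, smul_eq_mul,
    Circle.coe_zpow, mul_zpow]
  rw [zpow_neg (r : ℂ) m]
  field_simp

/-- Parseval's formula on the circle of radius `r`. -/
lemma hasSum_circleAverage_mul_conj {f g : ℂ → ℂ} {r : ℝ} (hr : 0 < r)
    (hf : ContinuousOn f (Metric.sphere 0 r)) (hg : ContinuousOn g (Metric.sphere 0 r)) :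
    HasSum (fun m : ℤ => Real.circleAverage (fun z => f z * z ^ (-m)) 0 r *
      conj (Real.circleAverage (fun z => g z * z ^ (-m)) 0 r) * (r : ℂ) ^ (2 * m))
      (Real.circleAverage (fun z => f z * conj (g z)) 0 r) := by
  have h := fourierBasis.hasSum_inner_mul_inner
    (ContinuousMap.toLp (E := ℂ) 2 AddCircle.haarAddCircle ℂ (onCircle g hr hg))
    (ContinuousMap.toLp (E := ℂ) 2 AddCircle.haarAddCircle ℂ (onCircle f hr hf))
  rw [ContinuousMap.inner_toLp] at h
  rw [circleAverage_eq_integral_haar (fun z => f z * conj (g z))]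
  convert! h using 1
  ext m
  rw [← inner_conj_symm, ← HilbertBasis.repr_apply_apply, ← HilbertBasis.repr_apply_apply,
    fourierBasis_repr, fourierBasis_repr, fourierCoeff_toLp, fourierCoeff_toLp,
    fourierCoeff_onCircle, fourierCoeff_onCircle]
  have hr' : (r : ℂ) ≠ 0 := by exact_mod_cast hr.ne'
  simp only [map_mul, map_zpow₀, Complex.conj_ofReal]
  rw [mul_comm 2 m, zpow_mul, zpow_ofNat]
  ring

/-! ### Laurent series in the Hardy space of the annulus -/

/-- The Laurent coefficients of a function on the annulus, computed on the middle circle. -/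
def laurentCoeff (a b : ℝ) (f : ℂ → ℂ) (m : ℤ) : ℂ :=
  Real.circleAverage (fun z => f z * z ^ (-m)) 0 ((a + b) / 2)

/-- The square of the norm of `z ^ m` in `H²` of the annulus. -/
def weight (a b : ℝ) (m : ℤ) : ℝ := a ^ (2 * m) + b ^ (2 * m)

section Annulus

variable {a b : ℝ} {f g : ℂ → ℂ}

lemma mem_annulus {z : ℂ} : z ∈ annulus a b ↔ a < ‖z‖ ∧ ‖z‖ < b := Iff.rfl

lemma sphere_subset_annulus {r : ℝ} (hr : r ∈ Ioo a b) :
    Metric.sphere (0 : ℂ) r ⊆ annulus a b := fun z hz => by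
  have : ‖z‖ = r := by simpa using hz
  exact mem_annulus.2 (this ▸ hr)

lemma weight_pos (ha : 0 < a) (hb : 0 < b) (m : ℤ) : 0 < weight a b m := by
  unfold weight
  positivity

lemma zpow_le_weight (ha : 0 < a) {r : ℝ} (hr : r ∈ Ioo a b) (m : ℤ) :
    r ^ (2 * m) ≤ weight a b m := by
  have hr0 : 0 < r := ha.trans hr.1
  have hb : 0 < b := hr0.trans hr.2
  unfold weight
  rcases le_total 0 m with h | h
  · have := zpow_le_zpow_left₀ (by omega : 0 ≤ 2 * m) hr0.le hr.2.le
    have : 0 < a ^ (2 * m) := by positivity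
    linarith
  · have h1 := zpow_le_zpow_left₀ (by omega : 0 ≤ -(2 * m)) ha.le hr.1.le
    rw [zpow_neg, zpow_neg, inv_le_inv₀ (by positivity) (by positivity)] at h1
    have : 0 < b ^ (2 * m) := by positivity
    linarith

lemma differentiableOn_zpow (ha : 0 < a) (m : ℤ) :
    DifferentiableOn ℂ (fun z : ℂ => z ^ m) (annulus a b) := fun z hz => by
  have : z ≠ 0 := norm_pos_iff.1 (ha.trans (mem_annulus.1 hz).1)
  exact ((differentiableAt_zpow (m := m)).2 (Or.inl this)).differentiableWithinAt

/-- Cauchy's theorem: the Laurent coefficients can be computed on any circle. -/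
lemma circleAverage_mul_zpow (ha : 0 < a) (hf : DifferentiableOn ℂ f (annulus a b)) {r : ℝ}
    (hr : r ∈ Ioo a b) (m : ℤ) :
    Real.circleAverage (fun z => f z * z ^ (-m)) 0 r = laurentCoeff a b f m := by
  have hd : DifferentiableOn ℂ (fun z => f z * z ^ (-m)) (annulus a b) :=
    hf.mul (differentiableOn_zpow ha _)
  have key : ∀ r ∈ Ioo a b, ∀ s ∈ Ioo a b, r ≤ s →
      Real.circleAverage (fun z => f z * z ^ (-m)) 0 s =
        Real.circleAverage (fun z => f z * z ^ (-m)) 0 r := fun r hr s hs hrs => by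
    rw [Real.circleAverage_eq_circleIntegral (ha.trans hr.1).ne',
      Real.circleAverage_eq_circleIntegral (ha.trans hs.1).ne']
    congr 1
    refine Complex.circleIntegral_sub_center_inv_smul_eq_of_differentiable_on_annulus_off_countable
      (ha.trans hr.1) hrs countable_empty (hd.continuousOn.mono fun z hz => ?_) fun z hz => ?_
    · have h1 : ‖z‖ ≤ s ∧ r ≤ ‖z‖ := by simpa using hz
      exact mem_annulus.2 ⟨hr.1.trans_le h1.2, h1.1.trans_lt hs.2⟩
    · have h1 : ‖z‖ < s ∧ r < ‖z‖ := by simpa using hz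
      exact hd.differentiableAt ((annulus a b).isOpen.mem_nhds
        (mem_annulus.2 ⟨hr.1.trans h1.2, h1.1.trans hs.2⟩))
  have hmid : (a + b) / 2 ∈ Ioo a b := by
    have := hr.1.trans hr.2
    constructor <;> linarith
  rcases le_total r ((a + b) / 2) with h | h
  · exact (key r hr _ hmid h).symm
  · exact key _ hmid r hr h

lemma hasSum_circleAverage (ha : 0 < a) (hf : DifferentiableOn ℂ f (annulus a b))
    (hg : DifferentiableOn ℂ g (annulus a b)) {r : ℝ} (hr : r ∈ Ioo a b) :
    HasSum (fun m => laurentCoeff a b f m * conj (laurentCoeff a b g m) * (r : ℂ) ^ (2 * m))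
      (Real.circleAverage (fun z => f z * conj (g z)) 0 r) := by
  have h := hasSum_circleAverage_mul_conj (ha.trans hr.1)
    (hf.continuousOn.mono (sphere_subset_annulus hr))
    (hg.continuousOn.mono (sphere_subset_annulus hr))
  simpa only [circleAverage_mul_zpow ha hf hr, circleAverage_mul_zpow ha hg hr] using h

lemma hasSum_meanTwo_sq (ha : 0 < a) (hf : DifferentiableOn ℂ f (annulus a b)) {r : ℝ}
    (hr : r ∈ Ioo a b) :
    HasSum (fun m => ‖laurentCoeff a b f m‖ ^ 2 * r ^ (2 * m)) (meanTwo f r ^ 2) := by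
  have h := hasSum_circleAverage ha hf hf hr
  have h1 : Real.circleAverage (fun z => f z * conj (f z)) 0 r =
      ((Real.circleAverage (fun z => ‖f z‖ ^ 2) 0 r : ℝ) : ℂ) := by
    simp only [circleAverage_eq_integral_haar, Complex.mul_conj']
    rw [← integral_complex_ofReal]
    simp only [Complex.ofReal_pow]
  rw [h1] at h
  simp only [Complex.mul_conj'] at h
  rw [meanTwo, Real.sq_sqrt (Real.circleAverage_nonneg_of_nonneg fun _ _ => by positivity)]
  exact_mod_cast h

lemma continuousAt_zpow_real {x : ℝ} (hx : 0 < x) (m : ℤ) :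
    ContinuousAt (fun r : ℝ => r ^ m) x := continuousAt_zpow₀ x m (Or.inl hx.ne')

/-- A holomorphic function on the annulus is in `H²` if and only if its Laurent coefficients are
square summable with the weights `a ^ (2m) + b ^ (2m)`. -/
lemma memH2_iff (ha : 0 < a) (hab : a < b) :
    MemH2 a b f ↔ DifferentiableOn ℂ f (annulus a b) ∧
      Summable fun m => ‖laurentCoeff a b f m‖ ^ 2 * weight a b m := by
  have hb := ha.trans hab
  refine and_congr_right fun hf => ⟨fun ⟨M, hM⟩ => ?_, fun h => ?_⟩
  · have hle : ∀ r ∈ Ioo a b, ∀ s : Finset ℤ,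
        ∑ m ∈ s, ‖laurentCoeff a b f m‖ ^ 2 * r ^ (2 * m) ≤ M ^ 2 := fun r hr s => by
      have h1 := hasSum_meanTwo_sq ha hf hr
      have h0 : 0 < r := ha.trans hr.1
      refine (sum_le_hasSum s (fun m _ => by positivity) h1).trans ?_
      have : meanTwo f r ≤ M := hM ⟨r, hr, rfl⟩
      have : 0 ≤ meanTwo f r := Real.sqrt_nonneg _
      gcongr
    have hcont : ∀ s : Finset ℤ, ∀ x > 0,
        ContinuousAt (fun r : ℝ => ∑ m ∈ s, ‖laurentCoeff a b f m‖ ^ 2 * r ^ (2 * m)) x :=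
      fun s x hx => tendsto_finsetSum _ fun m _ =>
        tendsto_const_nhds.mul (continuousAt_zpow_real hx _)
    refine summable_of_sum_le (c := M ^ 2 + M ^ 2)
      (fun m => mul_nonneg (by positivity) (weight_pos ha hb m).le) fun s => ?_
    simp only [weight, mul_add, Finset.sum_add_distrib]
    refine add_le_add ?_ ?_
    · refine le_of_tendsto ((hcont s a ha).tendsto.mono_left nhdsWithin_le_nhds)
        (f := fun r : ℝ => ∑ m ∈ s, ‖laurentCoeff a b f m‖ ^ 2 * r ^ (2 * m)) (x := 𝓝[>] a) ?_
      filter_upwards [Ioo_mem_nhdsGT hab] with r hr using hle r hr s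
    · refine le_of_tendsto ((hcont s b hb).tendsto.mono_left nhdsWithin_le_nhds)
        (f := fun r : ℝ => ∑ m ∈ s, ‖laurentCoeff a b f m‖ ^ 2 * r ^ (2 * m)) (x := 𝓝[<] b) ?_
      filter_upwards [Ioo_mem_nhdsLT hab] with r hr using hle r hr s
  · refine ⟨√(∑' m, ‖laurentCoeff a b f m‖ ^ 2 * weight a b m), ?_⟩
    rintro _ ⟨r, hr, rfl⟩
    refine Real.le_sqrt_of_sq_le ?_
    have h1 := hasSum_meanTwo_sq ha hf hr
    rw [← h1.tsum_eq]
    exact h1.summable.tsum_le_tsum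
      (fun m => mul_le_mul_of_nonneg_left (zpow_le_weight ha hr m) (by positivity)) h

/-- The inner product of `H²` in terms of the Laurent coefficients: the circle averages converge
at both ends of `(a, b)` by dominated convergence in Parseval's formula. -/
lemma hasSum_h2Inner (ha : 0 < a) (hab : a < b) (hf : MemH2 a b f) (hg : MemH2 a b g) :
    HasSum (fun m => laurentCoeff a b f m * conj (laurentCoeff a b g m) * weight a b m)
      (h2Inner a b f g) := by
  have hb := ha.trans hab
  obtain ⟨hfd, hfs⟩ := (memH2_iff ha hab).1 hf
  obtain ⟨hgd, hgs⟩ := (memH2_iff ha hab).1 hg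
  set c : ℤ → ℂ := fun m => laurentCoeff a b f m * conj (laurentCoeff a b g m)
  have hs : Summable fun m => ‖c m‖ * weight a b m := by
    refine (summable_mul_of_sq (f := fun m => ‖laurentCoeff a b f m‖ * √(weight a b m))
      (g := fun m => ‖laurentCoeff a b g m‖ * √(weight a b m)) ?_ ?_).congr fun m => ?_
    · exact hfs.congr fun m => by rw [mul_pow, Real.sq_sqrt (weight_pos ha hb m).le]
    · exact hgs.congr fun m => by rw [mul_pow, Real.sq_sqrt (weight_pos ha hb m).le]
    · simp only [c, norm_mul, RCLike.norm_conj]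
      rw [mul_mul_mul_comm, Real.mul_self_sqrt (weight_pos ha hb m).le]
  have key : ∀ x > 0, ∀ l : Filter ℝ, l ≤ 𝓝 x → (∀ᶠ r in l, r ∈ Ioo a b) →
      Tendsto (fun r => Real.circleAverage (fun z => f z * conj (g z)) 0 r) l
        (𝓝 (∑' m, c m * (x : ℂ) ^ (2 * m))) := fun x hx l hl hmem => by
    have h1 : Tendsto (fun r : ℝ => ∑' m, c m * (r : ℂ) ^ (2 * m)) l
        (𝓝 (∑' m, c m * (x : ℂ) ^ (2 * m))) := by
      refine tendsto_tsum_of_dominated_convergence hs (fun m => ?_) ?_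
      · have : ContinuousAt (fun r : ℝ => (r : ℂ) ^ (2 * m)) x :=
          ContinuousAt.comp (g := fun z : ℂ => z ^ (2 * m))
            (continuousAt_zpow₀ _ _ (Or.inl (by exact_mod_cast hx.ne')))
            Complex.continuous_ofReal.continuousAt
        exact tendsto_const_nhds.mul (this.tendsto.mono_left hl)
      · filter_upwards [hmem] with r hr m
        rw [norm_mul, norm_zpow, Complex.norm_real, Real.norm_of_nonneg (ha.trans hr.1).le]
        exact mul_le_mul_of_nonneg_left (zpow_le_weight ha hr m) (norm_nonneg _)
    refine h1.congr' ?_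
    filter_upwards [hmem] with r hr
    exact (hasSum_circleAverage ha hfd hgd hr).tsum_eq
  have hsum : ∀ x > 0, (∀ m, x ^ (2 * m) ≤ weight a b m) →
      Summable fun m => c m * (x : ℂ) ^ (2 * m) := fun x hx h =>
    hs.of_norm_bounded fun m => by
      rw [norm_mul, norm_zpow, Complex.norm_real, Real.norm_of_nonneg hx.le]
      exact mul_le_mul_of_nonneg_left (h m) (norm_nonneg _)
  have ha' : Summable fun m => c m * (a : ℂ) ^ (2 * m) := hsum a ha fun m => by
    have : 0 < b ^ (2 * m) := by positivity
    simp only [weight]; linarith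
  have hb' : Summable fun m => c m * (b : ℂ) ^ (2 * m) := hsum b hb fun m => by
    have : 0 < a ^ (2 * m) := by positivity
    simp only [weight]; linarith
  rw [h2Inner, (key a ha (𝓝[>] a) nhdsWithin_le_nhds (Ioo_mem_nhdsGT hab)).limUnder_eq,
    (key b hb (𝓝[<] b) nhdsWithin_le_nhds (Ioo_mem_nhdsLT hab)).limUnder_eq]
  convert! ha'.hasSum.add hb'.hasSum using 1
  ext m
  simp [weight, c, mul_add]

lemma hasSum_h2Norm_sq (ha : 0 < a) (hab : a < b) (hf : MemH2 a b f) :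
    HasSum (fun m => ‖laurentCoeff a b f m‖ ^ 2 * weight a b m) (h2Norm a b f ^ 2) := by
  have h := (hasSum_h2Inner ha hab hf hf).mapL Complex.reCLM
  have h1 : ∀ m, Complex.reCLM (laurentCoeff a b f m * conj (laurentCoeff a b f m) *
      weight a b m) = ‖laurentCoeff a b f m‖ ^ 2 * weight a b m := fun m => by
    rw [Complex.mul_conj', ← Complex.ofReal_pow, ← Complex.ofReal_mul]
    exact Complex.ofReal_re _
  simp only [h1] at h
  rw [h2Norm, Real.sq_sqrt]
  · exact h
  · exact h.nonneg fun m => mul_nonneg (by positivity) (weight_pos ha (ha.trans hab) m).le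

lemma norm_sq_laurentCoeff_le (ha : 0 < a) (hab : a < b) (hf : MemH2 a b f) (m : ℤ) :
    ‖laurentCoeff a b f m‖ ^ 2 * weight a b m ≤ h2Norm a b f ^ 2 :=
  le_hasSum (hasSum_h2Norm_sq ha hab hf) m fun m _ =>
    mul_nonneg (by positivity) (weight_pos ha (ha.trans hab) m).le

/-- The squared norm of the evaluation functional on `H²` at a point of modulus `r`. -/
lemma tsum_zpow_div_weight_le (ha : 0 < a) {r : ℝ} (hr : r ∈ Ioo a b) :
    (Summable fun m : ℤ => r ^ (2 * m) / weight a b m) ∧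
      ∑' m : ℤ, r ^ (2 * m) / weight a b m ≤ 2 / min (1 - r / b) (r / a - 1) := by
  have hr0 : 0 < r := ha.trans hr.1
  have hb : 0 < b := hr0.trans hr.2
  set q := r / b
  set s := a / r
  have hq0 : 0 < q := by positivity
  have hs0 : 0 < s := by positivity
  have hq : q < 1 := (div_lt_one hb).2 hr.2
  have hs : s < 1 := (div_lt_one hr0).2 hr.1
  have hq2 : q ^ 2 < 1 := by nlinarith
  have hs2 : s ^ 2 < 1 := by nlinarith
  have hnn : ∀ m : ℤ, 0 ≤ r ^ (2 * m) / weight a b m := fun m =>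
    div_nonneg (by positivity) (weight_pos ha hb m).le
  have h1 : ∀ m : ℕ, r ^ (2 * (m : ℤ)) / weight a b m ≤ (q ^ 2) ^ m := fun m => by
    have e : (q ^ 2) ^ m = r ^ (2 * (m : ℤ)) / b ^ (2 * (m : ℤ)) := by
      rw [← pow_mul, div_pow]; norm_cast
    rw [e]
    have : 0 < a ^ (2 * (m : ℤ)) := by positivity
    gcongr
    simp only [weight]; linarith
  have h2 : ∀ m : ℕ, r ^ (2 * (-((m : ℤ) + 1))) / weight a b (-((m : ℤ) + 1)) ≤
      s ^ 2 * (s ^ 2) ^ m := fun m => by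
    have e : s ^ 2 * (s ^ 2) ^ m = r ^ (2 * (-((m : ℤ) + 1))) / a ^ (2 * (-((m : ℤ) + 1))) := by
      rw [← pow_succ', ← pow_mul, div_pow, mul_neg, zpow_neg, zpow_neg, inv_div_inv]
      norm_cast
    rw [e]
    have : 0 < b ^ (2 * (-((m : ℤ) + 1))) := by positivity
    gcongr
    simp only [weight]; linarith
  have g1 := hasSum_geometric_of_lt_one (by positivity) hq2
  have g2 := (hasSum_geometric_of_lt_one (by positivity) hs2).mul_left (s ^ 2)
  have s1 : Summable fun m : ℕ => r ^ (2 * (m : ℤ)) / weight a b m :=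
    g1.summable.of_nonneg_of_le (fun m => hnn _) h1
  have s2 : Summable fun m : ℕ => r ^ (2 * (-((m : ℤ) + 1))) / weight a b (-((m : ℤ) + 1)) :=
    g2.summable.of_nonneg_of_le (fun m => hnn _) h2
  have hS := HasSum.of_nat_of_neg_add_one (f := fun m : ℤ => r ^ (2 * m) / weight a b m)
    s1.hasSum s2.hasSum
  refine ⟨hS.summable, ?_⟩
  rw [hS.tsum_eq]
  have t1 := s1.tsum_le_tsum h1 g1.summable
  have t2 := s2.tsum_le_tsum h2 g2.summable
  rw [g1.tsum_eq] at t1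
  rw [g2.tsum_eq] at t2
  have hra : 0 < r / a - 1 := sub_pos.2 ((one_lt_div ha).2 hr.1)
  have hm : 0 < min (1 - q) (r / a - 1) := lt_min (by linarith) hra
  have e1 : (1 - q ^ 2)⁻¹ ≤ 1 / min (1 - q) (r / a - 1) := by
    rw [← one_div]
    gcongr
    exact (min_le_left _ _).trans (by nlinarith)
  have e2 : s ^ 2 * (1 - s ^ 2)⁻¹ ≤ 1 / min (1 - q) (r / a - 1) := by
    have : s ^ 2 * (1 - s ^ 2)⁻¹ = 1 / ((r / a) ^ 2 - 1) := by
      have hs' : r / a = s⁻¹ := by simp [s]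
      have h3 : 1 - s ^ 2 ≠ 0 := by linarith
      rw [hs']
      field_simp
    rw [this]
    gcongr
    exact (min_le_right _ _).trans (by nlinarith)
  calc _ ≤ 1 / min (1 - q) (r / a - 1) + 1 / min (1 - q) (r / a - 1) := by linarith
    _ = _ := by ring

/-- A square summable sequence of coefficients gives an absolutely convergent Laurent series. -/
lemma summable_norm_mul_zpow (ha : 0 < a) {α : ℤ → ℂ}
    (hα : Summable fun m => ‖α m‖ ^ 2 * weight a b m) {r : ℝ} (hr : r ∈ Ioo a b) :
    (Summable fun m => ‖α m‖ * r ^ m) ∧ ∑' m, ‖α m‖ * r ^ m ≤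
      √(∑' m, ‖α m‖ ^ 2 * weight a b m) * √(2 / min (1 - r / b) (r / a - 1)) := by
  have hb : 0 < b := (ha.trans hr.1).trans hr.2
  obtain ⟨h1, h2⟩ := tsum_zpow_div_weight_le ha hr
  have e1 : ∀ m, (‖α m‖ * √(weight a b m)) ^ 2 = ‖α m‖ ^ 2 * weight a b m := fun m => by
    rw [mul_pow, Real.sq_sqrt (weight_pos ha hb m).le]
  have e2 : ∀ m, (r ^ m / √(weight a b m)) ^ 2 = r ^ (2 * m) / weight a b m := fun m => by
    rw [div_pow, Real.sq_sqrt (weight_pos ha hb m).le, mul_comm 2 m, zpow_mul, zpow_ofNat]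
  have e3 : ∀ m, ‖α m‖ * √(weight a b m) * (r ^ m / √(weight a b m)) = ‖α m‖ * r ^ m :=
    fun m => by
      have := (Real.sqrt_pos.2 (weight_pos ha hb m)).ne'
      field_simp
  have s1 : Summable fun m => (‖α m‖ * √(weight a b m)) ^ 2 := by simpa only [e1] using hα
  have s2 : Summable fun m => (r ^ m / √(weight a b m)) ^ 2 := by simpa only [e2] using h1
  have h3 := summable_mul_of_sq s1 s2
  have h4 := tsum_mul_le_sqrt_mul_sqrt s1 s2
  simp only [e1, e2, e3] at h3 h4
  exact ⟨h3, h4.trans (by gcongr)⟩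

lemma summable_mul_zpow (ha : 0 < a) {α : ℤ → ℂ}
    (hα : Summable fun m => ‖α m‖ ^ 2 * weight a b m) {z : ℂ} (hz : z ∈ annulus a b) :
    Summable fun m => α m * z ^ m :=
  (summable_norm_mul_zpow ha hα (mem_annulus.1 hz)).1.of_norm_bounded fun m => by
    rw [norm_mul, norm_zpow]

/-- The Laurent expansion of a function in `H²`, from the pointwise convergence of absolutely
summable Fourier series on circles. -/
lemma hasSum_laurent (ha : 0 < a) (hab : a < b) (hf : MemH2 a b f) {z : ℂ}
    (hz : z ∈ annulus a b) : HasSum (fun m => laurentCoeff a b f m * z ^ m) (f z) := by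
  obtain ⟨hfd, hfs⟩ := (memH2_iff ha hab).1 hf
  have hr : 0 < ‖z‖ := ha.trans (mem_annulus.1 hz).1
  have hc := hfd.continuousOn.mono (sphere_subset_annulus (mem_annulus.1 hz))
  have hco : ∀ m, fourierCoeff (onCircle f hr hc) m = (‖z‖ : ℂ) ^ m * laurentCoeff a b f m :=
    fun m => by rw [fourierCoeff_onCircle, circleAverage_mul_zpow ha hfd (mem_annulus.1 hz)]
  have hs : Summable (fourierCoeff (onCircle f hr hc)) :=
    (summable_norm_mul_zpow ha hfs (mem_annulus.1 hz)).1.of_norm_bounded fun m => by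
      rw [hco, norm_mul, norm_zpow, Complex.norm_real, norm_norm, mul_comm]
  have h := has_pointwise_sum_fourier_series_of_summable hs (Complex.arg z : ℝ)
  have hz' : (‖z‖ : ℂ) * AddCircle.toCircle
      ((Complex.arg z : ℝ) : AddCircle (2 * Real.pi)) = z := by
    rw [AddCircle.toCircle_apply_mk, div_self Real.two_pi_pos.ne', one_mul, Circle.coe_exp]
    exact Complex.norm_mul_exp_arg_mul_I z
  have e1 : onCircle f hr hc ((Complex.arg z : ℝ) : AddCircle (2 * Real.pi)) = f z :=
    congr_arg f hz'
  rw [e1] at h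
  convert! h using 1
  ext m
  rw [hco, fourier_apply, AddCircle.toCircle_zsmul, smul_eq_mul, Circle.coe_zpow]
  nth_rw 1 [← hz']
  rw [mul_zpow]
  ring

/-- Point evaluations are bounded on `H²`, with a norm that blows up at the boundary. -/
lemma norm_le_h2Norm (ha : 0 < a) (hab : a < b) (hf : MemH2 a b f) {z : ℂ}
    (hz : z ∈ annulus a b) :
    ‖f z‖ ≤ h2Norm a b f * √(2 / min (1 - ‖z‖ / b) (‖z‖ / a - 1)) := by
  obtain ⟨hfd, hfs⟩ := (memH2_iff ha hab).1 hf
  obtain ⟨h1, h2⟩ := summable_norm_mul_zpow ha hfs (mem_annulus.1 hz)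
  rw [(hasSum_h2Norm_sq ha hab hf).tsum_eq,
    Real.sqrt_sq (show 0 ≤ h2Norm a b f from Real.sqrt_nonneg _)] at h2
  rw [← (hasSum_laurent ha hab hf hz).tsum_eq]
  refine (tsum_of_norm_bounded h1.hasSum fun m => ?_).trans h2
  rw [norm_mul, norm_zpow]

/-- The sum of a Laurent series. -/
def laurentSum (α : ℤ → ℂ) (z : ℂ) : ℂ := ∑' m, α m * z ^ m

variable {α : ℤ → ℂ}

lemma differentiableOn_laurentSum (ha : 0 < a)
    (hα : Summable fun m => ‖α m‖ ^ 2 * weight a b m) :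
    DifferentiableOn ℂ (laurentSum α) (annulus a b) := fun z hz => by
  obtain ⟨s, hs, hs'⟩ := exists_between (mem_annulus.1 hz).1
  obtain ⟨t, ht, ht'⟩ := exists_between (mem_annulus.1 hz).2
  have hs0 : 0 < s := ha.trans hs
  have hst : s < t := hs'.trans ht
  have h1 := (summable_norm_mul_zpow ha hα (r := s) ⟨hs, hst.trans ht'⟩).1
  have h2 := (summable_norm_mul_zpow ha hα (r := t) ⟨hs.trans hst, ht'⟩).1
  have hsub : (annulus s t : Set ℂ) ⊆ annulus a b := fun w hw =>
    mem_annulus.2 ⟨hs.trans (mem_annulus.1 hw).1, (mem_annulus.1 hw).2.trans ht'⟩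
  have := Complex.differentiableOn_tsum_of_summable_norm (h1.add h2)
    (F := fun m z => α m * z ^ m) (U := annulus s t)
    (fun m => (differentiableOn_zpow hs0 m).const_mul _) (annulus s t).isOpen fun m w hw => by
      obtain ⟨hw1, hw2⟩ := mem_annulus.1 hw
      have hw0 : 0 < ‖w‖ := hs0.trans hw1
      have ht0 : 0 < t := hw0.trans hw2
      rw [norm_mul, norm_zpow, ← mul_add]
      refine mul_le_mul_of_nonneg_left ?_ (norm_nonneg _)
      rcases le_total 0 m with h | h
      · have h3 := zpow_le_zpow_left₀ h hw0.le hw2.le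
        have : 0 < s ^ m := by positivity
        linarith
      · have h3 := zpow_le_zpow_left₀ (by omega : 0 ≤ -m) hs0.le hw1.le
        rw [zpow_neg, zpow_neg, inv_le_inv₀ (by positivity) (by positivity)] at h3
        have : 0 < t ^ m := by positivity
        linarith
  exact (this.differentiableAt ((annulus s t).isOpen.mem_nhds
    (mem_annulus.2 ⟨hs', ht⟩))).differentiableWithinAt

lemma circleAverage_zpow (r : ℝ) (m : ℤ) :
    Real.circleAverage (fun z : ℂ => z ^ m) 0 r = if m = 0 then 1 else 0 := by
  have h := congr_fun (fourierCoeff_fourier (T := 2 * Real.pi) m) 0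
  rw [circleAverage_eq_integral_haar]
  have e : ∀ t : AddCircle (2 * Real.pi), ((r : ℂ) * AddCircle.toCircle t) ^ m =
      (r : ℂ) ^ m * (fourier (-0) t • fourier m t) := fun t => by
    simp [fourier_apply, AddCircle.toCircle_zsmul, mul_zpow]
  simp_rw [e, integral_const_mul]
  rw [fourierCoeff] at h
  rw [h]
  by_cases hm : m = 0
  · simp [hm]
  · simp [hm, Ne.symm hm]

lemma laurentCoeff_laurentSum (ha : 0 < a) (hab : a < b)
    (hα : Summable fun m => ‖α m‖ ^ 2 * weight a b m) (m : ℤ) :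
    laurentCoeff a b (laurentSum α) m = α m := by
  set r := (a + b) / 2
  have hr : r ∈ Ioo a b := by constructor <;> simp only [r] <;> linarith
  have hr0 : 0 < r := ha.trans hr.1
  have hrC : (r : ℂ) ≠ 0 := by exact_mod_cast hr0.ne'
  have hs := (summable_norm_mul_zpow ha hα hr).1
  have hz : ∀ t : AddCircle (2 * Real.pi), (r : ℂ) * AddCircle.toCircle t ≠ 0 := fun t =>
    mul_ne_zero hrC (Circle.coe_ne_zero _)
  set F : ℤ → AddCircle (2 * Real.pi) → ℂ := fun j t =>
    α j * ((r : ℂ) * AddCircle.toCircle t) ^ (j - m)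
  have hFc : ∀ j, Continuous (F j) := fun j => continuous_const.mul
    ((continuous_const.mul continuous_coe_toCircle).zpow₀ _
      fun t => Or.inl (hz t))
  have hFn : ∀ j t, ‖F j t‖ = ‖α j‖ * r ^ j * r ^ (-m) := fun j t => by
    simp only [F]
    rw [norm_mul, norm_zpow, norm_mul, Circle.norm_coe, mul_one, Complex.norm_real,
      Real.norm_of_nonneg hr0.le, sub_eq_add_neg, zpow_add₀ hr0.ne', mul_assoc]
  have h := hasSum_integral_of_summable_integral_norm (μ := AddCircle.haarAddCircle) (F := F)
    (fun j => (hFc j).integrable_of_hasCompactSupport (HasCompactSupport.of_compactSpace _))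
    (by
      simp only [hFn, integral_const, probReal_univ, one_smul]
      exact hs.mul_right _)
  have e1 : ∀ j, ∫ t, F j t ∂AddCircle.haarAddCircle = if j = m then α m else 0 := fun j => by
    have := circleAverage_zpow r (j - m)
    rw [circleAverage_eq_integral_haar] at this
    simp only [F, integral_const_mul, this, sub_eq_zero]
    by_cases hj : j = m <;> simp [hj]
  have e2 : ∫ t, ∑' j, F j t ∂AddCircle.haarAddCircle = laurentCoeff a b (laurentSum α) m := by
    rw [laurentCoeff, circleAverage_eq_integral_haar]
    congr 1
    ext t
    rw [laurentSum, ← tsum_mul_right]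
    congr 1
    ext j
    simp only [F]
    rw [sub_eq_add_neg, zpow_add₀ (hz t), mul_assoc]
  simp only [e1] at h
  rw [e2] at h
  exact h.unique (hasSum_ite_eq m (α m))

lemma memH2_laurentSum (ha : 0 < a) (hab : a < b)
    (hα : Summable fun m => ‖α m‖ ^ 2 * weight a b m) : MemH2 a b (laurentSum α) :=
  (memH2_iff ha hab).2 ⟨differentiableOn_laurentSum ha hα, by
    simpa only [laurentCoeff_laurentSum ha hab hα] using hα⟩

end Annulus

/-! ### The component spaces -/

/-- The exponents `k + 2j` and `-d - k + 2 + 2j`, `j ≥ 0`, of the powers that span `V_{k,d}`. -/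
def exponents (d k : ℕ) : Set ℤ :=
  {m | ∃ j : ℕ, m = k + 2 * j ∨ m = -(d : ℤ) - k + 2 + 2 * j}

section Components

variable {a b : ℝ} {f g : ℂ → ℂ} {d k : ℕ}

lemma laurentCoeff_congr (ha : 0 < a) (hab : a < b) (h : EqOn f g (annulus a b)) (m : ℤ) :
    laurentCoeff a b f m = laurentCoeff a b g m := by
  refine Real.circleAverage_congr_sphere fun z hz => ?_
  rw [abs_of_pos (by linarith)] at hz
  have : z ∈ (annulus a b : Set ℂ) :=
    sphere_subset_annulus ⟨by linarith, by linarith⟩ hz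
  simp only [h this]

lemma laurentCoeff_sub (ha : 0 < a) (hab : a < b) (hf : DifferentiableOn ℂ f (annulus a b))
    (hg : DifferentiableOn ℂ g (annulus a b)) (m : ℤ) :
    laurentCoeff a b (f - g) m = laurentCoeff a b f m - laurentCoeff a b g m := by
  have hi : ∀ f, DifferentiableOn ℂ f (annulus a b) →
      CircleIntegrable (fun z => f z * z ^ (-m)) 0 ((a + b) / 2) := fun f hf =>
    ((hf.mul (differentiableOn_zpow ha _)).continuousOn.mono
      (sphere_subset_annulus ⟨by linarith, by linarith⟩)).circleIntegrable (by linarith)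
  simp only [laurentCoeff, Pi.sub_apply, sub_mul]
  exact Real.circleAverage_fun_sub (hi f hf) (hi g hg)

lemma MemH2.sub (ha : 0 < a) (hab : a < b) (hf : MemH2 a b f) (hg : MemH2 a b g) :
    MemH2 a b (f - g) := by
  obtain ⟨hfd, hfs⟩ := (memH2_iff ha hab).1 hf
  obtain ⟨hgd, hgs⟩ := (memH2_iff ha hab).1 hg
  refine (memH2_iff ha hab).2 ⟨hfd.sub hgd, ?_⟩
  refine ((hfs.add hgs).mul_left 2).of_nonneg_of_le
    (fun m => mul_nonneg (by positivity) (weight_pos ha (ha.trans hab) m).le) fun m => ?_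
  rw [laurentCoeff_sub ha hab hfd hgd, ← add_mul, ← mul_assoc]
  refine mul_le_mul_of_nonneg_right ?_ (weight_pos ha (ha.trans hab) m).le
  have h1 := norm_sub_le (laurentCoeff a b f m) (laurentCoeff a b g m)
  have h2 := norm_nonneg (laurentCoeff a b f m - laurentCoeff a b g m)
  nlinarith [sq_nonneg (‖laurentCoeff a b f m‖ - ‖laurentCoeff a b g m‖)]

lemma laurentSpan_eq : laurentSpan d k =
    Submodule.span ℂ ((fun (m : ℤ) (z : ℂ) => z ^ m) '' exponents d k) := by
  rw [laurentSpan]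
  congr 1
  ext f
  simp only [mem_union, mem_range, mem_image, exponents, mem_ofPred_eq]
  constructor
  · rintro (⟨j, rfl⟩ | ⟨j, rfl⟩)
    · exact ⟨_, ⟨j, Or.inl rfl⟩, rfl⟩
    · exact ⟨_, ⟨j, Or.inr rfl⟩, rfl⟩
  · rintro ⟨m, ⟨j, rfl | rfl⟩, rfl⟩
    · exact Or.inl ⟨j, rfl⟩
    · exact Or.inr ⟨j, rfl⟩

/-- The elements of `V_{k,d}` are the finite Laurent sums with the admissible exponents. -/
lemma mem_laurentSpan_iff : f ∈ laurentSpan d k ↔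
    ∃ α : ℤ →₀ ℂ, (∀ m ∉ exponents d k, α m = 0) ∧ laurentSum α = f := by
  rw [laurentSpan_eq, Finsupp.mem_span_image_iff_linearCombination]
  refine exists_congr fun α => and_congr ?_ ?_
  · rw [Finsupp.mem_supported']
  · have : laurentSum α = Finsupp.linearCombination ℂ (fun (m : ℤ) (z : ℂ) => z ^ m) α := by
      ext z
      rw [laurentSum, Finsupp.linearCombination_apply, Finsupp.sum, Finset.sum_apply,
        tsum_eq_sum (s := α.support) fun m hm => by simp [Finsupp.notMem_support_iff.1 hm]]
      rfl
    rw [this]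

lemma summable_finsupp (α : ℤ →₀ ℂ) : Summable fun m => ‖α m‖ ^ 2 * weight a b m :=
  summable_of_ne_finset_zero (s := α.support) fun m hm => by
    simp [Finsupp.notMem_support_iff.1 hm]

/-- Laurent coefficients are continuous for the norm of `H²`, so the vanishing of the coefficients
at the other exponents passes from `V_{k,d}` to its closure. -/
lemma MemH2Component.laurentCoeff_eq_zero (ha : 0 < a) (hab : a < b)
    (hf : MemH2Component a b d k f) {m : ℤ} (hm : m ∉ exponents d k) :
    laurentCoeff a b f m = 0 := by
  by_contra h0
  have hw := weight_pos ha (ha.trans hab) m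
  have h1 : 0 < ‖laurentCoeff a b f m‖ * √(weight a b m) :=
    mul_pos (norm_pos_iff.2 h0) (Real.sqrt_pos.2 hw)
  obtain ⟨p, hp, hlt⟩ := hf.2 _ h1
  obtain ⟨α, hα, rfl⟩ := mem_laurentSpan_iff.1 hp
  have hαs := summable_finsupp (a := a) (b := b) α
  have hp2 := memH2_laurentSum ha hab hαs
  have h2 := norm_sq_laurentCoeff_le ha hab (hf.1.sub ha hab hp2) m
  rw [laurentCoeff_sub ha hab hf.1.1 hp2.1, laurentCoeff_laurentSum ha hab hαs, hα m hm,
    sub_zero] at h2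
  have h3 : h2Norm a b (f - laurentSum α) ^ 2 < (‖laurentCoeff a b f m‖ * √(weight a b m)) ^ 2 :=
    pow_lt_pow_left₀ hlt (Real.sqrt_nonneg _) two_ne_zero
  rw [mul_pow, Real.sq_sqrt hw.le] at h3
  exact absurd h2 (not_le.2 h3)

/-- Square summable Laurent series with the admissible exponents are in the component space:
the partial sums approximate them. -/
lemma memH2Component_laurentSum (ha : 0 < a) (hab : a < b) {α : ℤ → ℂ}
    (hα : Summable fun m => ‖α m‖ ^ 2 * weight a b m) (hsupp : ∀ m ∉ exponents d k, α m = 0) :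
    MemH2Component a b d k (laurentSum α) := by
  have hf := memH2_laurentSum ha hab hα
  refine ⟨hf, fun ε hε => ?_⟩
  obtain ⟨s, hs⟩ := ((tendsto_order.1 (tendsto_tsum_compl_atTop_zero
    fun m => ‖α m‖ ^ 2 * weight a b m)).2 (ε ^ 2) (by positivity)).exists
  -- the coefficients of the approximating partial sum
  set β : ℤ →₀ ℂ := Finsupp.onFinset s (fun m => if m ∈ s then α m else 0)
    (fun m hm => by by_contra h; simp [h] at hm)
  have hβ : ∀ m, β m = if m ∈ s then α m else 0 := fun m => rfl
  have hβs := summable_finsupp (a := a) (b := b) β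
  have hp := memH2_laurentSum ha hab hβs
  refine ⟨laurentSum β, mem_laurentSpan_iff.2 ⟨β, fun m hm => ?_, rfl⟩, ?_⟩
  · rw [hβ, hsupp m hm, ite_self]
  · refine lt_of_pow_lt_pow_left₀ 2 hε.le ?_
    rw [← (hasSum_h2Norm_sq ha hab (hf.sub ha hab hp)).tsum_eq]
    refine lt_of_eq_of_lt ?_ hs
    have hsub : Function.support (fun m => ‖laurentCoeff a b (laurentSum α - laurentSum β) m‖ ^ 2 *
        weight a b m) ⊆ {m | m ∉ s} := fun m hm hms => hm (by
      simp [laurentCoeff_sub ha hab hf.1 hp.1, laurentCoeff_laurentSum ha hab hα,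
        laurentCoeff_laurentSum ha hab hβs, hβ, hms])
    rw [← tsum_subtype_eq_of_support_subset hsub]
    refine tsum_congr fun ⟨m, hm⟩ => ?_
    have hm' : m ∉ s := hm
    simp [laurentCoeff_sub ha hab hf.1 hp.1, laurentCoeff_laurentSum ha hab hα,
        laurentCoeff_laurentSum ha hab hβs, hβ, hm']

end Components

/-! ### Convergence of the expansions -/

/-- The factor by which point evaluation on `H²` of the annulus is bounded at modulus `r`. -/
def evalBound (a b r : ℝ) : ℝ := √(2 / min (1 - r / b) (r / a - 1))

section Series

variable {a b L ρ : ℝ} {n : ℕ} {Y : Index (n + 1) → MvPolynomial (Fin (n + 1)) ℝ}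
  {D : Index (n + 1) → ℝ} {c e : Index (n + 1) → ℂ → ℂ}
  {f : ComplexifiedAnnulus a b (n + 1) → ℂ}

lemma IsHardyFamily.norm_term_le (hc : IsHardyFamily a b L c) (ha : 0 < a) (hab : a < b)
    (hD : ∀ i (x : EuclideanSpace ℝ (Fin (n + 1))), ‖x‖ ≤ ρ → |evalAt (Y i) x| ≤ D i)
    (i : Index (n + 1)) {z : ℂ} (hz : z ∈ annulus a b) {x : EuclideanSpace ℝ (Fin (n + 1))}
    (hx : ‖x‖ ≤ ρ) :
    ‖c i z * (evalAt (Y i) x : ℂ)‖ ≤ evalBound a b ‖z‖ * (h2Norm a b (c i) * D i) := by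
  have h1 := norm_le_h2Norm ha hab (hc.1 i).1 hz
  have h2 := hD i x hx
  have h3 : 0 ≤ h2Norm a b (c i) := Real.sqrt_nonneg _
  rw [norm_mul, Complex.norm_real, Real.norm_eq_abs]
  calc _ ≤ (h2Norm a b (c i) * evalBound a b ‖z‖) * D i :=
        mul_le_mul h1 h2 (abs_nonneg _) (mul_nonneg h3 (Real.sqrt_nonneg _))
    _ = _ := by ring

lemma IsHardyFamily.summable_bound (hc : IsHardyFamily a b L c) (hL : 0 < L)
    (hDs : Summable fun i => D i ^ 2 / L ^ (2 * i.1)) :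
    (Summable fun i => h2Norm a b (c i) * D i) ∧
      ∑' i, h2Norm a b (c i) * D i ≤ √(∑' i, h2Norm a b (c i) ^ 2 * L ^ (2 * i.1)) *
        √(∑' i, D i ^ 2 / L ^ (2 * i.1)) := by
  have e1 : ∀ i, (h2Norm a b (c i) * L ^ i.1) ^ 2 = h2Norm a b (c i) ^ 2 * L ^ (2 * i.1) :=
    fun i => by rw [mul_pow, ← pow_mul, mul_comm i.1]
  have e2 : ∀ i, (D i / L ^ i.1) ^ 2 = D i ^ 2 / L ^ (2 * i.1) :=
    fun i => by rw [div_pow, ← pow_mul, mul_comm i.1]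
  have e3 : ∀ i, h2Norm a b (c i) * L ^ i.1 * (D i / L ^ i.1) = h2Norm a b (c i) * D i :=
    fun i => by
      have : L ^ i.1 ≠ 0 := by positivity
      field_simp
  have s1 : Summable fun i => (h2Norm a b (c i) * L ^ i.1) ^ 2 := by simpa only [e1] using hc.2
  have s2 : Summable fun i => (D i / L ^ i.1) ^ 2 := by simpa only [e2] using hDs
  have h1 := summable_mul_of_sq s1 s2
  have h2 := tsum_mul_le_sqrt_mul_sqrt s1 s2
  simp only [e1, e2, e3] at h1 h2
  exact ⟨h1, h2⟩

lemma IsHardyFamily.summable_term (hc : IsHardyFamily a b L c) (ha : 0 < a) (hab : a < b)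
    (hL : 0 < L) (hDs : Summable fun i => D i ^ 2 / L ^ (2 * i.1))
    (hD : ∀ i (x : EuclideanSpace ℝ (Fin (n + 1))), ‖x‖ ≤ ρ → |evalAt (Y i) x| ≤ D i)
    {z : ℂ} (hz : z ∈ annulus a b) {x : EuclideanSpace ℝ (Fin (n + 1))} (hx : ‖x‖ ≤ ρ) :
    Summable fun i => c i z * (evalAt (Y i) x : ℂ) :=
  ((hc.summable_bound hL hDs).1.mul_left _).of_norm_bounded
    fun i => hc.norm_term_le ha hab hD i hz hx

/-- Every family of finite norm has a sum. -/
lemma IsHardyFamily.hasHardyExpansion (hc : IsHardyFamily a b L c) (hY : IsHarmonicBasis Y)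
    (ha : 0 < a) (hab : a < b) (hL : 1 < L) :
    HasHardyExpansion a b L Y (fun p => ∑' i, c i p.1 * (onSphere (Y i) p.2 : ℂ)) c := by
  obtain ⟨ρ, hρ, D, -, hD, hDs⟩ := hY.exists_bound hL
  refine ⟨hc, fun p => Summable.hasSum ?_⟩
  refine hc.summable_term ha hab (by linarith) hDs hD p.1.2 (x := p.2) ?_
  simpa using hρ.le

/-- The components of a function are its Fourier coefficients with respect to the harmonic basis,
so they are determined on the annulus. -/
lemma HasHardyExpansion.integral_mul (hf : HasHardyExpansion a b L Y f c)
    (hY : IsHarmonicBasis Y) (ha : 0 < a) (hab : a < b) (hL : 1 < L) (z : annulus a b)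
    (j : Index (n + 1)) :
    ∫ θ, f (z, θ) * (onSphere (Y j) θ : ℂ) ∂surface n = c j z := by
  obtain ⟨ρ, hρ, D, hD0, hD, hDs⟩ := hY.exists_bound hL
  have hsph : ∀ θ : Sphere (n + 1), ‖(θ : EuclideanSpace ℝ (Fin (n + 1)))‖ ≤ ρ := fun θ => by
    simpa using hρ.le
  set F : Index (n + 1) → Sphere (n + 1) → ℂ := fun i θ =>
    c i z * (onSphere (Y i) θ : ℂ) * (onSphere (Y j) θ : ℂ)
  have hFc : ∀ i, Continuous (F i) := fun i =>
    (continuous_const.mul (Complex.continuous_ofReal.comp (continuous_onSphere _))).mul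
      (Complex.continuous_ofReal.comp (continuous_onSphere _))
  have hFn : ∀ i θ, ‖F i θ‖ ≤ evalBound a b ‖(z : ℂ)‖ * (h2Norm a b (c i) * D i) * D j :=
    fun i θ => by
      rw [norm_mul, Complex.norm_real, Real.norm_eq_abs]
      exact mul_le_mul (hf.1.norm_term_le ha hab hD i z.2 (hsph θ)) (hD j _ (hsph θ))
        (abs_nonneg _) (mul_nonneg (Real.sqrt_nonneg _)
          (mul_nonneg (Real.sqrt_nonneg _) (hD0 i)))
  have h := hasSum_integral_of_summable_integral_norm (μ := surface n) (F := F)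
    (fun i => integrable_of_continuous_sphere (hFc i)) (by
      refine Summable.of_nonneg_of_le (fun i => integral_nonneg fun θ => norm_nonneg _)
        (fun i => (integral_mono (integrable_of_continuous_sphere (hFc i)).norm
          (integrable_const _) (hFn i)).trans_eq (by rw [integral_const]))
        ((((hf.1.summable_bound (by linarith) hDs).1.mul_left _).mul_right (D j)).const_smul _))
  have e1 : ∀ i, ∫ θ, F i θ ∂surface n = if i = j then c j z else 0 := fun i => by
    have h1 : ∀ θ, F i θ = c i z * ((onSphere (Y i) θ * onSphere (Y j) θ : ℝ) : ℂ) := fun θ => by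
      simp only [F]; push_cast; ring
    simp_rw [h1, integral_const_mul]
    rw [integral_complex_ofReal, hY.integral_mul]
    by_cases hij : i = j <;> simp [hij]
  have e2 : ∀ θ, ∑' i, F i θ = f (z, θ) * (onSphere (Y j) θ : ℂ) := fun θ =>
    ((hf.2 (z, θ)).mul_right _).tsum_eq
  simp only [e1, e2] at h
  exact h.unique (hasSum_ite_eq j (c j z))

lemma HasHardyExpansion.laurentCoeff_eq (hf : HasHardyExpansion a b L Y f c)
    (hf' : HasHardyExpansion a b L Y f e) (hY : IsHarmonicBasis Y) (ha : 0 < a) (hab : a < b)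
    (hL : 1 < L) (i : Index (n + 1)) : laurentCoeff a b (c i) = laurentCoeff a b (e i) :=
  funext fun m => laurentCoeff_congr ha hab (fun z hz =>
    (hf.integral_mul hY ha hab hL ⟨z, hz⟩ i).symm.trans
      (hf'.integral_mul hY ha hab hL ⟨z, hz⟩ i)) m

end Series

/-! ### The sequence model of the polyharmonic Hardy space -/

/-- The index set of the orthogonal system `z ^ m Y_{k,ℓ}(θ)` with admissible exponents `m`. -/
abbrev ModelIndex (d : ℕ) : Type := Σ i : Index d, exponents d i.1

/-- Square summable coefficient sequences with respect to the normalized orthogonal system. -/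
abbrev Model (d : ℕ) : Type := lp (fun _ : ModelIndex d => ℂ) 2

open Classical in
/-- The Laurent coefficients of the component with index `i` of the element of the polyharmonic
Hardy space with normalized coefficients `v`; they vanish at the other exponents. -/
def modelCoeff (a b L : ℝ) {d : ℕ} (v : Model d) (i : Index d) (m : ℤ) : ℂ :=
  if h : m ∈ exponents d i.1 then
    v ⟨i, ⟨m, h⟩⟩ / ((√(weight a b m) * L ^ i.1 : ℝ) : ℂ) else 0

section Model

variable {a b L : ℝ} {d : ℕ}

lemma modelCoeff_of_notMem (v : Model d) {i : Index d} {m : ℤ} (h : m ∉ exponents d i.1) :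
    modelCoeff a b L v i m = 0 := dif_neg h

lemma modelCoeff_coe (v : Model d) (i : Index d) (m : exponents d i.1) :
    modelCoeff a b L v i m = v ⟨i, m⟩ / ((√(weight a b m) * L ^ i.1 : ℝ) : ℂ) :=
  dif_pos m.2

lemma modelCoeff_add (v u : Model d) (i : Index d) (m : ℤ) :
    modelCoeff a b L (v + u) i m = modelCoeff a b L v i m + modelCoeff a b L u i m := by
  by_cases h : m ∈ exponents d i.1
  · simp [modelCoeff, h, add_div]
  · simp [modelCoeff, h]

lemma modelCoeff_smul (t : ℂ) (v : Model d) (i : Index d) (m : ℤ) :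
    modelCoeff a b L (t • v) i m = t * modelCoeff a b L v i m := by
  by_cases h : m ∈ exponents d i.1
  · simp [modelCoeff, h, mul_div_assoc]
  · simp [modelCoeff, h]

lemma modelCoeff_mul_conj (ha : 0 < a) (hb : 0 < b) (hL : 0 < L) (v u : Model d) (i : Index d)
    (m : exponents d i.1) :
    modelCoeff a b L v i m * conj (modelCoeff a b L u i m) * weight a b m * (L : ℂ) ^ (2 * i.1) =
      inner ℂ (u ⟨i, m⟩) (v ⟨i, m⟩) := by
  have hw := weight_pos ha hb m
  have h1 : (√(weight a b m) : ℂ) ≠ 0 := by exact_mod_cast (Real.sqrt_pos.2 hw).ne'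
  have h2 : (L : ℂ) ≠ 0 := by exact_mod_cast hL.ne'
  have h3 : (weight a b m : ℂ) = (√(weight a b m) : ℂ) ^ 2 := by
    rw [← Complex.ofReal_pow, Real.sq_sqrt hw.le]
  rw [modelCoeff_coe, modelCoeff_coe, RCLike.inner_apply, map_div₀, Complex.conj_ofReal, h3]
  push_cast
  field_simp
  ring

lemma norm_modelCoeff_sq (ha : 0 < a) (hb : 0 < b) (hL : 0 < L) (v : Model d) (i : Index d)
    (m : exponents d i.1) :
    ‖modelCoeff a b L v i m‖ ^ 2 * weight a b m * L ^ (2 * i.1) = ‖v ⟨i, m⟩‖ ^ 2 := by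
  have h := modelCoeff_mul_conj ha hb hL v v i m
  rw [Complex.mul_conj', RCLike.inner_apply, Complex.mul_conj'] at h
  exact_mod_cast h

lemma summable_model (v : Model d) : Summable fun j => ‖v j‖ ^ 2 := by
  simpa using (memℓp_gen_iff (p := 2) (by simp)).1 (lp.memℓp v)

lemma summable_modelCoeff (ha : 0 < a) (hb : 0 < b) (hL : 0 < L) (v : Model d) (i : Index d) :
    Summable fun m => ‖modelCoeff a b L v i m‖ ^ 2 * weight a b m := by
  have h1 : Summable fun m : exponents d i.1 => ‖v ⟨i, m⟩‖ ^ 2 :=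
    (summable_model v).sigma_factor i
  have hsupp : Function.support (fun m => ‖modelCoeff a b L v i m‖ ^ 2 * weight a b m) ⊆
      exponents d i.1 := fun m hm => by
    by_contra h
    exact hm (by simp [modelCoeff_of_notMem v h])
  obtain ⟨x, hx⟩ := h1.mul_right (L ^ (2 * i.1))⁻¹
  refine ⟨x, (hasSum_subtype_iff_of_support_subset hsupp).1 ?_⟩
  convert! hx using 1
  ext m
  rw [← norm_modelCoeff_sq ha hb hL v i m]
  simp only [Function.comp_apply]
  field_simp

/-- The components of the element of the polyharmonic Hardy space with coefficients `v`. -/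
def modelComponent (a b L : ℝ) (v : Model d) (i : Index d) : ℂ → ℂ :=
  laurentSum (modelCoeff a b L v i)

lemma laurentCoeff_modelComponent (ha : 0 < a) (hab : a < b) (hL : 0 < L) (v : Model d)
    (i : Index d) : laurentCoeff a b (modelComponent a b L v i) = modelCoeff a b L v i :=
  funext fun m =>
    laurentCoeff_laurentSum ha hab (summable_modelCoeff ha (ha.trans hab) hL v i) m

lemma memH2Component_modelComponent (ha : 0 < a) (hab : a < b) (hL : 0 < L) (v : Model d)
    (i : Index d) : MemH2Component a b d i.1 (modelComponent a b L v i) :=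
  memH2Component_laurentSum ha hab (summable_modelCoeff ha (ha.trans hab) hL v i)
    fun _ hm => modelCoeff_of_notMem v hm

lemma hasSum_h2Inner_modelComponent (ha : 0 < a) (hab : a < b) (hL : 0 < L) (v u : Model d)
    (i : Index d) :
    HasSum (fun m : exponents d i.1 => inner ℂ (u ⟨i, m⟩) (v ⟨i, m⟩))
      (h2Inner a b (modelComponent a b L v i) (modelComponent a b L u i) *
        (L : ℂ) ^ (2 * i.1)) := by
  have h := (hasSum_h2Inner ha hab (memH2Component_modelComponent ha hab hL v i).1
    (memH2Component_modelComponent ha hab hL u i).1).mul_right ((L : ℂ) ^ (2 * i.1))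
  simp only [laurentCoeff_modelComponent ha hab hL] at h
  rw [← hasSum_subtype_iff_of_support_subset (s := exponents d i.1)] at h
  · convert! h using 1
    ext m
    exact (modelCoeff_mul_conj ha (ha.trans hab) hL v u i m).symm
  · intro m hm
    by_contra h0
    exact hm (by simp [modelCoeff_of_notMem v h0])

lemma hasSum_inner_model (ha : 0 < a) (hab : a < b) (hL : 0 < L) (v u : Model d) :
    HasSum (fun i => h2Inner a b (modelComponent a b L v i) (modelComponent a b L u i) *
      (L : ℂ) ^ (2 * i.1)) (inner ℂ u v) :=
  (lp.hasSum_inner u v).sigma fun i => hasSum_h2Inner_modelComponent ha hab hL v u i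

lemma hasSum_norm_sq_model (ha : 0 < a) (hab : a < b) (hL : 0 < L) (v : Model d) :
    HasSum (fun i => h2Norm a b (modelComponent a b L v i) ^ 2 * L ^ (2 * i.1)) (‖v‖ ^ 2) := by
  have h := (hasSum_inner_model ha hab hL v v).mapL Complex.reCLM
  rw [inner_self_eq_norm_sq_to_K] at h
  have e : Complex.reCLM ((‖v‖ : ℂ) ^ 2) = ‖v‖ ^ 2 := by
    rw [← Complex.ofReal_pow]; exact Complex.ofReal_re _
  rw [show ((‖v‖ : ℝ) : ℂ) ^ 2 = ((RCLike.ofReal ‖v‖ : ℂ)) ^ 2 from rfl] at e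
  rw [e] at h
  convert! h using 1
  ext i
  have hm := memH2Component_modelComponent ha hab hL v i
  have h1 := hasSum_h2Norm_sq ha hab hm.1
  have h2 := (hasSum_h2Inner ha hab hm.1 hm.1)
  have h3 : h2Inner a b (modelComponent a b L v i) (modelComponent a b L v i) =
      ((h2Norm a b (modelComponent a b L v i) ^ 2 : ℝ) : ℂ) := by
    refine h2.unique ?_
    have h4 := Complex.hasSum_ofReal.2 h1
    convert! h4 using 1
    ext m
    rw [Complex.mul_conj']
    push_cast
    rfl
  rw [h3]
  have : (((h2Norm a b (modelComponent a b L v i) ^ 2 : ℝ) : ℂ) * (L : ℂ) ^ (2 * i.1)) =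
      ((h2Norm a b (modelComponent a b L v i) ^ 2 * L ^ (2 * i.1) : ℝ) : ℂ) := by push_cast; rfl
  rw [this]
  exact (Complex.ofReal_re _).symm

lemma isHardyFamily_modelComponent (ha : 0 < a) (hab : a < b) (hL : 0 < L) (v : Model d) :
    IsHardyFamily a b L (modelComponent a b L v) :=
  ⟨memH2Component_modelComponent ha hab hL v, (hasSum_norm_sq_model ha hab hL v).summable⟩

lemma modelComponent_add (ha : 0 < a) (hab : a < b) (hL : 0 < L) (v u : Model d) (i : Index d)
    {z : ℂ} (hz : z ∈ annulus a b) :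
    modelComponent a b L (v + u) i z = modelComponent a b L v i z + modelComponent a b L u i z := by
  have hb := ha.trans hab
  rw [modelComponent, modelComponent, modelComponent, laurentSum, laurentSum, laurentSum,
    ← (summable_mul_zpow ha (summable_modelCoeff ha hb hL v i) hz).tsum_add
      (summable_mul_zpow ha (summable_modelCoeff ha hb hL u i) hz)]
  simp_rw [modelCoeff_add, add_mul]

lemma modelComponent_smul (t : ℂ) (v : Model d) (i : Index d) (z : ℂ) :
    modelComponent a b L (t • v) i z = t * modelComponent a b L v i z := by
  simp only [modelComponent, laurentSum, modelCoeff_smul, mul_assoc, tsum_mul_left]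

end Model

section Synthesis

variable {a b L : ℝ} {n : ℕ} {Y : Index (n + 1) → MvPolynomial (Fin (n + 1)) ℝ}
  {c e : Index (n + 1) → ℂ → ℂ} {f g : ComplexifiedAnnulus a b (n + 1) → ℂ}

/-- The linear map that sends a square summable sequence to the function on the complexified
annulus with these coefficients. -/
def synthesis (hY : IsHarmonicBasis Y) (ha : 0 < a) (hab : a < b) (hL : 1 < L) :
    Model (n + 1) →ₗ[ℂ] ComplexifiedAnnulus a b (n + 1) → ℂ where
  toFun v p := ∑' i, modelComponent a b L v i p.1 * (onSphere (Y i) p.2 : ℂ)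
  map_add' v u := by
    have hL0 : 0 < L := by linarith
    ext p
    have h := fun v => ((isHardyFamily_modelComponent ha hab hL0 v).hasHardyExpansion
      hY ha hab hL).2 p
    rw [Pi.add_apply, ← (h v).summable.tsum_add (h u).summable]
    refine tsum_congr fun i => ?_
    rw [modelComponent_add ha hab hL0 v u i p.1.2, add_mul]
  map_smul' t v := by
    ext p
    simp only [modelComponent_smul, mul_assoc, tsum_mul_left, Pi.smul_apply, smul_eq_mul,
      RingHom.id_apply]

variable (hY : IsHarmonicBasis Y) (ha : 0 < a) (hab : a < b) (hL : 1 < L)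

include hY ha hab hL

lemma hasHardyExpansion_synthesis (v : Model (n + 1)) :
    HasHardyExpansion a b L Y (synthesis hY ha hab hL v) (modelComponent a b L v) :=
  (isHardyFamily_modelComponent ha hab (by linarith) v).hasHardyExpansion hY ha hab hL

lemma synthesis_injective : Function.Injective (synthesis hY ha hab hL) := fun v u h => by
  have hL0 : 0 < L := by linarith
  have h1 := hasHardyExpansion_synthesis hY ha hab hL v
  rw [h] at h1
  ext ⟨i, m⟩
  have h2 := congr_fun (h1.laurentCoeff_eq (hasHardyExpansion_synthesis hY ha hab hL u)
    hY ha hab hL i) m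
  rw [laurentCoeff_modelComponent ha hab hL0, laurentCoeff_modelComponent ha hab hL0,
    modelCoeff_coe, modelCoeff_coe] at h2
  have h3 : ((√(weight a b m) * L ^ i.1 : ℝ) : ℂ) ≠ 0 := by
    have := Real.sqrt_pos.2 (weight_pos ha (ha.trans hab) m)
    exact_mod_cast (by positivity : √(weight a b m) * L ^ i.1 ≠ 0)
  exact (div_left_inj' h3).1 h2

/-- Every function with an expansion comes from the sequence of its weighted Laurent
coefficients. -/
lemma exists_synthesis_eq (hf : HasHardyExpansion a b L Y f c) :
    ∃ v, synthesis hY ha hab hL v = f := by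
  have hL0 : 0 < L := by linarith
  have hb := ha.trans hab
  set w : ModelIndex (n + 1) → ℂ := fun j =>
    laurentCoeff a b (c j.1) j.2 * ((√(weight a b j.2) * L ^ j.1.1 : ℝ) : ℂ)
  have hw : ∀ j, ‖w j‖ ^ 2 =
      ‖laurentCoeff a b (c j.1) j.2‖ ^ 2 * weight a b j.2 * L ^ (2 * j.1.1) := fun j => by
    have h1 := weight_pos ha hb j.2
    rw [norm_mul, Complex.norm_real, Real.norm_of_nonneg (by positivity), mul_pow, mul_pow,
      Real.sq_sqrt h1.le, ← pow_mul, mul_comm j.1.1, mul_assoc]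
  have hsum : ∀ i, HasSum (fun m : exponents (n + 1) i.1 => ‖w ⟨i, m⟩‖ ^ 2)
      (h2Norm a b (c i) ^ 2 * L ^ (2 * i.1)) := fun i => by
    simp only [hw]
    refine HasSum.mul_right _ ?_
    refine (hasSum_subtype_iff_of_support_subset
      (f := fun m => ‖laurentCoeff a b (c i) m‖ ^ 2 * weight a b m) fun m hm => ?_).2
      (hasSum_h2Norm_sq ha hab (hf.1.1 i).1)
    by_contra h0
    exact hm (by simp [(hf.1.1 i).laurentCoeff_eq_zero ha hab h0])
  have hmem : Memℓp w 2 := by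
    rw [memℓp_gen_iff (by simp)]
    simp only [ENNReal.toReal_ofNat, Real.rpow_ofNat]
    refine (summable_sigma_of_nonneg fun j => by positivity).2
      ⟨fun i => (hsum i).summable, ?_⟩
    simpa only [(hsum _).tsum_eq] using hf.1.2
  refine ⟨⟨w, hmem⟩, funext fun p => ?_⟩
  rw [← (hf.2 p).tsum_eq]
  refine tsum_congr fun i => ?_
  congr 1
  rw [← (hasSum_laurent ha hab (hf.1.1 i).1 p.1.2).tsum_eq]
  refine tsum_congr fun m => ?_
  congr 1
  by_cases hm : m ∈ exponents (n + 1) i.1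
  · have h1 := modelCoeff_coe (a := a) (b := b) (L := L) ⟨w, hmem⟩ i ⟨m, hm⟩
    have h3 : ((√(weight a b m) * L ^ i.1 : ℝ) : ℂ) ≠ 0 := by
      have := Real.sqrt_pos.2 (weight_pos ha hb m)
      exact_mod_cast (by positivity : √(weight a b m) * L ^ i.1 ≠ 0)
    exact h1.trans (mul_div_cancel_right₀ _ h3)
  · rw [modelCoeff_of_notMem _ hm, (hf.1.1 i).laurentCoeff_eq_zero ha hab hm]

lemma coe_range_synthesis :
    (LinearMap.range (synthesis hY ha hab hL) : Set (ComplexifiedAnnulus a b (n + 1) → ℂ)) =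
      hardySpace a b L Y := by
  ext f
  constructor
  · rintro ⟨v, rfl⟩
    exact ⟨_, hasHardyExpansion_synthesis hY ha hab hL v⟩
  · rintro ⟨c, hc⟩
    exact exists_synthesis_eq hY ha hab hL hc

/-- The inner product of the coefficient sequences is given by any expansions. -/
lemma hasSum_inner_of_hasHardyExpansion {v u : Model (n + 1)}
    (hv : HasHardyExpansion a b L Y (synthesis hY ha hab hL v) c)
    (hu : HasHardyExpansion a b L Y (synthesis hY ha hab hL u) e) :
    HasSum (fun i => h2Inner a b (c i) (e i) * (L : ℂ) ^ (2 * i.1)) (inner ℂ u v) := by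
  have hL0 : 0 < L := by linarith
  convert! hasSum_inner_model ha hab hL0 v u using 1
  ext i
  congr 1
  have h1 := hasSum_h2Inner ha hab (hv.1.1 i).1 (hu.1.1 i).1
  rw [hv.laurentCoeff_eq (hasHardyExpansion_synthesis hY ha hab hL v) hY ha hab hL,
    hu.laurentCoeff_eq (hasHardyExpansion_synthesis hY ha hab hL u) hY ha hab hL] at h1
  exact h1.unique (hasSum_h2Inner ha hab (memH2Component_modelComponent ha hab hL0 v i).1
    (memH2Component_modelComponent ha hab hL0 u i).1)

/-- Point evaluations are bounded by the norm, uniformly in the direction `θ`. -/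
lemma exists_norm_synthesis_le :
    ∃ C > 0, ∀ v (p : ComplexifiedAnnulus a b (n + 1)), ‖synthesis hY ha hab hL v p‖ ≤
      C / min (1 - ‖(p.1 : ℂ)‖ / b) (‖(p.1 : ℂ)‖ / a - 1) * ‖v‖ := by
  have hL0 : 0 < L := by linarith
  obtain ⟨ρ, hρ, D, -, hD, hDs⟩ := hY.exists_bound hL
  set A := √(∑' i, D i ^ 2 / L ^ (2 * i.1))
  have hA : 0 ≤ A := Real.sqrt_nonneg _
  refine ⟨2 * (A + 1), by positivity, fun v p => ?_⟩
  have hc := isHardyFamily_modelComponent ha hab hL0 v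
  obtain ⟨h1, h2⟩ := hc.summable_bound hL0 hDs
  rw [(hasSum_norm_sq_model ha hab hL0 v).tsum_eq, Real.sqrt_sq (norm_nonneg _)] at h2
  have h3 : ‖synthesis hY ha hab hL v p‖ ≤ evalBound a b ‖(p.1 : ℂ)‖ * (‖v‖ * A) := by
    refine (tsum_of_norm_bounded (h1.mul_left (evalBound a b ‖(p.1 : ℂ)‖)).hasSum
      fun i => hc.norm_term_le ha hab hD i p.1.2 (x := p.2) (by simpa using hρ.le)).trans ?_
    rw [tsum_mul_left]
    exact mul_le_mul_of_nonneg_left h2 (Real.sqrt_nonneg _)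
  set B := min (1 - ‖(p.1 : ℂ)‖ / b) (‖(p.1 : ℂ)‖ / a - 1)
  obtain ⟨hz1, hz2⟩ := mem_annulus.1 p.1.2
  have hB0 : 0 < B := lt_min (sub_pos.2 ((div_lt_one (ha.trans hab)).2 hz2))
    (sub_pos.2 ((one_lt_div ha).2 hz1))
  have hB1 : B ≤ 1 := (min_le_left _ _).trans (by
    have : 0 ≤ ‖(p.1 : ℂ)‖ / b := div_nonneg (norm_nonneg _) (ha.trans hab).le
    linarith)
  -- `2 / B ≥ 1` because `B ≤ 1`, so the square root can be dropped
  have h4 : evalBound a b ‖(p.1 : ℂ)‖ ≤ 2 / B := by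
    refine Real.sqrt_le_iff.2 ⟨by positivity, ?_⟩
    have : 1 ≤ 2 / B := (one_le_div hB0).2 (by linarith)
    change 2 / B ≤ (2 / B) ^ 2
    nlinarith
  calc _ ≤ 2 / B * (‖v‖ * (A + 1)) := h3.trans (by gcongr; linarith)
    _ = _ := by ring

end Synthesis

/-! ### Smoothness -/

section Smoothness

lemma integrable_comp_add_mul_kernel {V : Type*} [NormedAddCommGroup V] [InnerProductSpace ℝ V]
    [FiniteDimensional ℝ V] [MeasurableSpace V] [BorelSpace V] {δ : ℝ} (hδ : 0 < δ) {x : V}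
    {f : V → ℂ} (hf : ContinuousOn f (Metric.closedBall x δ)) :
    Integrable fun y : V => f (x + y) * (kernel δ (‖y‖ ^ 2) : ℂ) := by
  have h1 : ContinuousOn (fun y : V => f (x + y) * (kernel δ (‖y‖ ^ 2) : ℂ))
      (Metric.closedBall 0 δ) := by
    refine (hf.comp (by fun_prop) fun y hy => ?_).mul
      (Complex.continuous_ofReal.comp (contDiff_kernel_norm δ).continuous).continuousOn
    simpa using hy
  have h2 := (h1.integrableOn_compact (μ := volume) (isCompact_closedBall 0 δ))
  rw [← integrable_indicator_iff Metric.isClosed_closedBall.measurableSet] at h2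
  refine h2.congr (Eventually.of_forall fun y => ?_)
  by_cases hy : y ∈ Metric.closedBall (0 : V) δ
  · simp [hy]
  · have : δ < ‖y‖ := by simpa using hy
    simp [hy, kernel_norm_eq_zero hδ this.le]

/-- The mean value property of a holomorphic function, averaged over circles with the weight of
the mollifier. -/
lemma integral_holomorphic_add_mul_kernel {δ : ℝ} (hδ : 0 < δ) {z : ℂ} {f : ℂ → ℂ} {U : Set ℂ}
    (hf : DifferentiableOn ℂ f U) (hz : Metric.closedBall z δ ⊆ U) :
    ∫ w : ℂ, f (z + w) * (kernel δ (‖w‖ ^ 2) : ℂ) = f z * ∫ w : ℂ, (kernel δ (‖w‖ ^ 2) : ℂ) := by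
  have i1 := integrable_comp_add_mul_kernel hδ (hf.continuousOn.mono hz)
  have i2 : Integrable fun w : ℂ => f z * (kernel δ (‖w‖ ^ 2) : ℂ) :=
    integrable_comp_add_mul_kernel (x := z) (f := fun _ => f z) hδ continuousOn_const
  rw [← integral_const_mul, ← sub_eq_zero, ← integral_sub i1 i2,
    ← Complex.integral_comp_polarCoord_symm]
  set G : ℝ × ℝ → ℂ := fun p => p.1 • (f (z + Complex.polarCoord.symm p) *
    (kernel δ (‖Complex.polarCoord.symm p‖ ^ 2) : ℂ) -
      f z * (kernel δ (‖Complex.polarCoord.symm p‖ ^ 2) : ℂ))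
  change ∫ p in Ioi (0 : ℝ) ×ˢ Ioo (-Real.pi) Real.pi, G p = 0
  -- Fubini's theorem applies if `G` is integrable; otherwise the integral is `0` by convention
  by_cases hG : IntegrableOn G (Ioi (0 : ℝ) ×ˢ Ioo (-Real.pi) Real.pi) (volume.prod volume)
  swap
  · exact integral_undef hG
  rw [Measure.volume_eq_prod, setIntegral_prod _ hG]
  refine setIntegral_eq_zero_of_forall_eq_zero fun r (hr : 0 < r) => ?_
  have hGr : ∀ t, G (r, t) = ((r * kernel δ (r ^ 2) : ℝ) : ℂ) * (f (circleMap z r t) - f z) := by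
    intro t
    have h1 : z + Complex.polarCoord.symm (r, t) = circleMap z r t := by
      rw [Complex.polarCoord_symm_apply, circleMap, Complex.exp_mul_I]
      push_cast
      rfl
    have h2 : ‖Complex.polarCoord.symm (r, t)‖ = r := by
      rw [Complex.norm_polarCoord_symm, abs_of_pos hr]
    simp only [G, h1, h2, Complex.real_smul]
    push_cast
    ring
  simp_rw [hGr, integral_const_mul]
  rcases le_total δ r with h | h
  · rw [kernel_eq_zero hδ (by gcongr)]
    simp
  · have hsub : Metric.closedBall z |r| ⊆ U :=
      (Metric.closedBall_subset_closedBall (by rwa [abs_of_pos hr])).trans hz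
    have hd : DiffContOnCl ℂ (fun w => f w - f z) (Metric.ball z |r|) :=
      ((hf.sub (differentiableOn_const _)).mono
        (Metric.closure_ball_subset_closedBall.trans hsub)).diffContOnCl
    have h1 := hd.circleAverage
    rw [Real.circleAverage_eq_integral_add (-Real.pi),
      intervalIntegral.integral_comp_add_right (fun t => f (circleMap z r t) - f z),
      sub_self, smul_eq_zero] at h1
    have h2 := h1.resolve_left (inv_ne_zero Real.two_pi_pos.ne')
    rw [intervalIntegral.integral_of_le (by linarith [Real.pi_pos]), integral_Ioc_eq_integral_Ioo,
      show 0 + -Real.pi = -Real.pi by ring,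
      show 2 * Real.pi + -Real.pi = Real.pi by ring] at h2
    rw [h2, mul_zero]

variable {a b L ρ : ℝ} {n : ℕ} {Y : Index (n + 1) → MvPolynomial (Fin (n + 1)) ℝ}
  {D : Index (n + 1) → ℝ} {c : Index (n + 1) → ℂ → ℂ}

local notation "𝔼" => EuclideanSpace ℝ (Fin (n + 1))

lemma continuousOn_evalBound (ha : 0 < a) (hab : a < b) :
    ContinuousOn (evalBound a b) (Ioo a b) := by
  refine ContinuousOn.sqrt (ContinuousOn.div continuousOn_const (by fun_prop) fun r hr => ?_)
  have h1 : 0 < 1 - r / b := sub_pos.2 ((div_lt_one (ha.trans hab)).2 hr.2)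
  have h2 : 0 < r / a - 1 := sub_pos.2 ((one_lt_div ha).2 hr.1)
  exact (lt_min h1 h2).ne'

/-- The series converges to a smooth function also in a neighbourhood of the sphere: near each
point its sum is reproduced by convolution with a product of radial mollifiers, because every term
is, by the mean value properties of its two factors. -/
lemma IsHardyFamily.contDiffAt (hc : IsHardyFamily a b L c) (hY : IsHarmonicBasis Y)
    (ha : 0 < a) (hab : a < b) (hL : 0 < L) (hDs : Summable fun i => D i ^ 2 / L ^ (2 * i.1))
    (hD : ∀ i (x : 𝔼), ‖x‖ ≤ ρ → |evalAt (Y i) x| ≤ D i) {z₀ : ℂ} (hz₀ : z₀ ∈ annulus a b)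
    {x₀ : 𝔼} (hx₀ : ‖x₀‖ < ρ) :
    ContDiffAt ℝ ∞ (fun p : ℂ × 𝔼 => ∑' i, c i p.1 * (evalAt (Y i) p.2 : ℂ)) (z₀, x₀) := by
  obtain ⟨ε, hε, hball⟩ := Metric.isOpen_iff.1 (annulus a b).isOpen z₀ hz₀
  -- the mollifiers have radius `δ`, and the formula is proved within distance `δ` of the point
  obtain ⟨δ, hδ, hδ'⟩ : ∃ δ > 0, 2 * δ < min ε (ρ - ‖x₀‖) :=
    ⟨min ε (ρ - ‖x₀‖) / 4, by have := lt_min hε (sub_pos.2 hx₀); positivity, by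
      have := lt_min hε (sub_pos.2 hx₀); linarith⟩
  have hδε : 2 * δ < ε := hδ'.trans_le (min_le_left _ _)
  have hδρ : 2 * δ < ρ - ‖x₀‖ := hδ'.trans_le (min_le_right _ _)
  have hB1 : Metric.closedBall z₀ (2 * δ) ⊆ annulus a b :=
    (Metric.closedBall_subset_ball hδε).trans hball
  have hB2 : ∀ x ∈ Metric.closedBall x₀ (2 * δ), ‖x‖ ≤ ρ := fun x hx => by
    have h1 : ‖x - x₀‖ ≤ 2 * δ := by simpa [dist_eq_norm] using hx
    have h2 := norm_add_le (x - x₀) x₀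
    rw [sub_add_cancel] at h2
    linarith
  set K : Set (ℂ × 𝔼) := Metric.closedBall z₀ (2 * δ) ×ˢ Metric.closedBall x₀ (2 * δ)
  have hK : IsCompact K := (isCompact_closedBall _ _).prod (isCompact_closedBall _ _)
  obtain ⟨M, hM⟩ := (isCompact_closedBall z₀ (2 * δ)).exists_bound_of_continuousOn
    ((continuousOn_evalBound ha hab).comp continuous_norm.continuousOn
      fun z hz => mem_annulus.1 (hB1 hz))
  have hh : ∀ i, 0 ≤ h2Norm a b (c i) * D i := fun i =>
    mul_nonneg (Real.sqrt_nonneg _) ((abs_nonneg _).trans (hD i x₀ hx₀.le))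
  -- the terms, their sum and the uniform bound for the terms on the compact set
  set u : Index (n + 1) → ℂ × 𝔼 → ℂ := fun i p => c i p.1 * (evalAt (Y i) p.2 : ℂ)
  set F : ℂ × 𝔼 → ℂ := fun p => ∑' i, u i p
  set B : Index (n + 1) → ℝ := fun i => M * (h2Norm a b (c i) * D i)
  have hB : Summable B := (hc.summable_bound hL hDs).1.mul_left M
  have hu : ∀ i, ∀ p ∈ K, ‖u i p‖ ≤ B i := fun i p hp =>
    (hc.norm_term_le ha hab hD i (hB1 hp.1) (hB2 _ hp.2)).trans
      (mul_le_mul_of_nonneg_right ((le_abs_self _).trans (hM _ hp.1)) (hh i))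
  have huc : ∀ i, ContinuousOn (u i) K := fun i =>
    (((hc.1 i).1.1.continuousOn.mono hB1).comp continuousOn_fst fun p hp => hp.1).mul
      (Complex.continuous_ofReal.comp
        ((continuous_evalAt _).comp continuous_snd)).continuousOn
  have hFc : ContinuousOn F K := continuousOn_tsum huc hB hu
  have hFi : LocallyIntegrable (K.indicator F) volume :=
    ((integrable_indicator_iff hK.measurableSet).2
      (hFc.integrableOn_compact hK)).locallyIntegrable
  set Φ : ℂ × 𝔼 → ℝ := fun p => kernel δ (‖p.1‖ ^ 2) * kernel δ (‖p.2‖ ^ 2)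
  have hΦ : ContDiff ℝ ∞ Φ :=
    ((contDiff_kernel_norm δ).comp contDiff_fst).mul ((contDiff_kernel_norm δ).comp contDiff_snd)
  have hΦ0 : ∀ s : ℂ × 𝔼, δ ≤ ‖s‖ → Φ s = 0 := fun s hs => by
    rcases le_max_iff.1 hs with h | h
    · simp [Φ, kernel_norm_eq_zero hδ h]
    · simp [Φ, kernel_norm_eq_zero hδ h]
  have hΦs : HasCompactSupport Φ :=
    HasCompactSupport.intro (isCompact_closedBall (0 : ℂ × 𝔼) δ) fun s hs => hΦ0 s (by
      have : δ < ‖s‖ := by simpa using hs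
      exact this.le)
  have hG : ContDiff ℝ ∞ (convolution (K.indicator F) Φ
      (ContinuousLinearMap.lsmul ℝ ℝ : ℝ →L[ℝ] ℂ →L[ℝ] ℂ).flip volume) :=
    hΦs.contDiff_convolution_right _ hFi hΦ
  set A₁ := ∫ w : ℂ, (kernel δ (‖w‖ ^ 2) : ℂ)
  set A₂ := ∫ y : 𝔼, (kernel δ (‖y‖ ^ 2) : ℂ)
  have hA₁ : A₁ ≠ 0 := by
    simp only [A₁, integral_complex_ofReal]
    exact_mod_cast (integral_kernel_pos (V := ℂ) hδ).ne'
  have hA₂ : A₂ ≠ 0 := by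
    simp only [A₂, integral_complex_ofReal]
    exact_mod_cast (integral_kernel_pos (V := 𝔼) hδ).ne'
  have key : ∀ q ∈ Metric.ball (z₀, x₀) δ, convolution (K.indicator F) Φ
      (ContinuousLinearMap.lsmul ℝ ℝ : ℝ →L[ℝ] ℂ →L[ℝ] ℂ).flip volume q = F q * (A₁ * A₂) := by
    intro q hq
    have hq1 : dist q.1 z₀ < δ := (le_max_left _ _).trans_lt hq
    have hq2 : dist q.2 x₀ < δ := (le_max_right _ _).trans_lt hq
    have hqK : ∀ s : ℂ × 𝔼, ‖s.1‖ ≤ δ → ‖s.2‖ ≤ δ → q + s ∈ K := fun s h1 h2 => by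
      constructor
      · have := dist_triangle (q + s).1 q.1 z₀
        have h3 : dist (q + s).1 q.1 = ‖s.1‖ := by simp [dist_eq_norm]
        exact Metric.mem_closedBall.2 (by linarith)
      · have := dist_triangle (q + s).2 q.2 x₀
        have h3 : dist (q + s).2 q.2 = ‖s.2‖ := by simp [dist_eq_norm]
        exact Metric.mem_closedBall.2 (by linarith)
    have hball1 : Metric.closedBall q.1 δ ⊆ annulus a b := fun w hw => hB1 (by
      have := hqK (w - q.1, 0) (by simpa [dist_eq_norm] using hw) (by simpa using hδ.le)
      simpa using this.1)
    have e1 : convolution (K.indicator F) Φ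
        (ContinuousLinearMap.lsmul ℝ ℝ : ℝ →L[ℝ] ℂ →L[ℝ] ℂ).flip volume q =
          ∫ s, ∑' i, u i (q + s) * (Φ s : ℂ) := by
      have : (volume : Measure (ℂ × 𝔼)).IsAddLeftInvariant := by
        rw [Measure.volume_eq_prod]
        infer_instance
      rw [convolution_def, ← integral_add_left_eq_self _ q]
      congr 1
      ext s
      have hneg : Φ (q - (q + s)) = Φ s := by simp [Φ]
      simp only [ContinuousLinearMap.flip_apply, ContinuousLinearMap.lsmul_apply, hneg,
        Complex.real_smul]
      rcases le_total δ ‖s‖ with h | h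
      · simp [hΦ0 s h]
      · rw [indicator_of_mem (hqK s ((norm_fst_le s).trans h) ((norm_snd_le s).trans h)),
          tsum_mul_right, mul_comm]
    have i1 : ∀ i, Integrable fun w : ℂ => c i (q.1 + w) * (kernel δ (‖w‖ ^ 2) : ℂ) := fun i =>
      integrable_comp_add_mul_kernel hδ ((hc.1 i).1.1.continuousOn.mono hball1)
    have i2 : ∀ i, Integrable fun y : 𝔼 =>
        (evalAt (Y i) (q.2 + y) : ℂ) * (kernel δ (‖y‖ ^ 2) : ℂ) := fun i =>
      integrable_comp_add_mul_kernel (f := fun x => (evalAt (Y i) x : ℂ)) hδ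
        (Complex.continuous_ofReal.comp (continuous_evalAt _)).continuousOn
    have e2 : ∀ i (s : ℂ × 𝔼), u i (q + s) * (Φ s : ℂ) =
        (c i (q.1 + s.1) * (kernel δ (‖s.1‖ ^ 2) : ℂ)) *
          ((evalAt (Y i) (q.2 + s.2) : ℂ) * (kernel δ (‖s.2‖ ^ 2) : ℂ)) := fun i s => by
      simp only [u, Φ, Prod.fst_add, Prod.snd_add]
      push_cast
      ring
    have hint : ∀ i, Integrable fun s : ℂ × 𝔼 => u i (q + s) * (Φ s : ℂ) := fun i => by
      simp_rw [e2]
      exact (i1 i).mul_prod (i2 i)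
    have hval : ∀ i, ∫ s, u i (q + s) * (Φ s : ℂ) = u i q * (A₁ * A₂) := fun i => by
      simp_rw [e2]
      rw [Measure.volume_eq_prod, integral_prod_mul
        (fun w : ℂ => c i (q.1 + w) * (kernel δ (‖w‖ ^ 2) : ℂ))
        (fun y : 𝔼 => (evalAt (Y i) (q.2 + y) : ℂ) * (kernel δ (‖y‖ ^ 2) : ℂ)),
        integral_holomorphic_add_mul_kernel hδ (hc.1 i).1.1 hball1]
      have h1 := integral_evalAt_add_mul_kernel hδ (hY.laplacian_eq i) q.2
      have h2 : ∫ y : 𝔼, (evalAt (Y i) (q.2 + y) : ℂ) * (kernel δ (‖y‖ ^ 2) : ℂ) =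
          (evalAt (Y i) q.2 : ℂ) * A₂ := by
        simp only [A₂, ← Complex.ofReal_mul, integral_complex_ofReal, h1]
      rw [h2]
      simp only [u, A₁]
      ring
    have hΦi : Integrable Φ := hΦ.continuous.integrable_of_hasCompactSupport hΦs
    have hΦnn : ∀ s, 0 ≤ Φ s := fun s => mul_nonneg (kernel_nonneg _ _) (kernel_nonneg _ _)
    have h := hasSum_integral_of_summable_integral_norm hint (by
      refine Summable.of_nonneg_of_le (fun i => integral_nonneg fun s => norm_nonneg _)
        (fun i => (integral_mono (hint i).norm (hΦi.const_mul (B i)) fun s => ?_).trans_eq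
          (integral_const_mul _ _)) (hB.mul_right _)
      dsimp only
      rw [norm_mul, Complex.norm_real, Real.norm_of_nonneg (hΦnn s)]
      rcases le_total δ ‖s‖ with h | h
      · simp [hΦ0 s h]
      · exact mul_le_mul_of_nonneg_right
          (hu i _ (hqK s ((norm_fst_le s).trans h) ((norm_snd_le s).trans h))) (hΦnn s))
    rw [e1, ← h.tsum_eq]
    simp_rw [hval, tsum_mul_right]
    rfl
  refine ((hG.div_const (A₁ * A₂)).contDiffAt).congr_of_eventuallyEq ?_
  filter_upwards [Metric.ball_mem_nhds (z₀, x₀) hδ] with q hq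
  rw [key q hq, mul_div_cancel_right₀ _ (mul_ne_zero hA₁ hA₂)]

lemma contMDiff_synthesis (hY : IsHarmonicBasis Y) (ha : 0 < a) (hab : a < b) (hL : 1 < L)
    (v : Model (n + 1)) :
    ContMDiff (𝓘(ℝ, ℂ).prod (𝓡 n)) 𝓘(ℝ, ℂ) ∞ (synthesis hY ha hab hL v) := fun p => by
  obtain ⟨ρ, hρ, D, -, hD, hDs⟩ := hY.exists_bound hL
  have hp : ‖(p.2 : 𝔼)‖ < ρ := by simpa using hρ
  have := Fact.mk (finrank_euclideanSpace_fin (𝕜 := ℝ) (n := n + 1))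
  have h1 := (isHardyFamily_modelComponent ha hab (by linarith) v).contDiffAt hY ha hab
    (by linarith) hDs hD p.1.2 hp
  have h2 : ContMDiffAt (𝓘(ℝ, ℂ).prod (𝓡 n)) 𝓘(ℝ, ℂ × 𝔼) ∞
      (fun p : ComplexifiedAnnulus a b (n + 1) => ((p.1 : ℂ), (p.2 : 𝔼))) p :=
    ContMDiffAt.prodMk_space
      (contMDiff_subtype_val.contMDiffAt.comp p contMDiffAt_fst)
      ((contMDiff_coe_sphere (E := 𝔼) (n := n)).contMDiffAt.comp p contMDiffAt_snd)
  exact ContMDiffAt.comp (g := fun q : ℂ × 𝔼 =>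
    ∑' i, modelComponent a b L v i q.1 * (evalAt (Y i) q.2 : ℂ)) p h1.contMDiffAt h2

end Smoothness

/-! ### Transport of the Hilbert space structure -/

section Transport

variable {V W : Type*} [NormedAddCommGroup V] [InnerProductSpace ℂ V] [AddCommGroup W] [Module ℂ W]

/-- The inner product on `W` transported from `V` along a linear equivalence. -/
@[reducible]
def transportCore (e : V ≃ₗ[ℂ] W) : InnerProductSpace.Core ℂ W where
  inner x y := inner ℂ (e.symm x) (e.symm y)
  conj_inner_symm x y := inner_conj_symm _ _
  re_inner_nonneg x := inner_self_nonneg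
  add_left x y z := by rw [map_add, inner_add_left]
  smul_left x y r := by rw [map_smul, inner_smul_left]
  definite x hx := by simpa using inner_self_eq_zero.1 hx

lemma normOf_transportCore (e : V ≃ₗ[ℂ] W) (x : V) : normOf (transportCore e) (e x) = ‖x‖ := by
  change √(inner ℂ (e.symm (e x)) (e.symm (e x))).re = ‖x‖
  rw [e.symm_apply_apply]
  exact (norm_eq_sqrt_re_inner (𝕜 := ℂ) x).symm

lemma completeFor_transportCore [CompleteSpace V] (e : V ≃ₗ[ℂ] W) :
    CompleteFor (transportCore e) := by
  let _ : NormedAddCommGroup W := (transportCore e).toNormedAddCommGroup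
  have h : Isometry e := AddMonoidHomClass.isometry_of_norm e fun x => normOf_transportCore e x
  exact (h.isUniformInducing.completeSpace_congr e.surjective).1 inferInstance

end Transport

end PolyharmonicHardy

end

theorem mainTheorem2 (n : ℕ) (a b L : ℝ) (ha : 0 < a) (hab : a < b) (hL : 1 < L)
    (Y : PolyharmonicHardy.Index (n + 1) → MvPolynomial (Fin (n + 1)) ℝ)
    (hY : PolyharmonicHardy.IsHarmonicBasis Y) :
    -- the series of every family of finite norm converges, to an element of the space
    (∀ c : PolyharmonicHardy.Index (n + 1) → ℂ → ℂ, PolyharmonicHardy.IsHardyFamily a b L c →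
      ∃ f, PolyharmonicHardy.HasHardyExpansion a b L Y f c) ∧
    -- the space is a linear space with the stated inner product
    ∃ (H : Submodule ℂ (PolyharmonicHardy.ComplexifiedAnnulus a b (n + 1) → ℂ))
      (ip : InnerProductSpace.Core ℂ H),
      (H : Set (PolyharmonicHardy.ComplexifiedAnnulus a b (n + 1) → ℂ)) =
        PolyharmonicHardy.hardySpace a b L Y ∧
      (∀ (f g : H) (c e : PolyharmonicHardy.Index (n + 1) → ℂ → ℂ),
        PolyharmonicHardy.HasHardyExpansion a b L Y f c →
        PolyharmonicHardy.HasHardyExpansion a b L Y g e →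
        HasSum (fun i => PolyharmonicHardy.h2Inner a b (c i) (e i) * (L : ℂ) ^ (2 * i.1))
          (ip.inner g f)) ∧
      -- 1. completeness
      PolyharmonicHardy.CompleteFor ip ∧
      -- 2. maximum principle
      (∀ K : Set (PolyharmonicHardy.ComplexifiedAnnulus a b (n + 1)), IsCompact K →
        ∃ C > 0, ∀ f : H, ∀ p ∈ K,
          ‖(f : PolyharmonicHardy.ComplexifiedAnnulus a b (n + 1) → ℂ) p‖ ≤
            C / min (1 - ‖(p.1 : ℂ)‖ / b) (‖(p.1 : ℂ)‖ / a - 1) *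
              PolyharmonicHardy.normOf ip f) ∧
      -- 3. smoothness
      (∀ f : H, ContMDiff (𝓘(ℝ, ℂ).prod (𝓡 n)) 𝓘(ℝ, ℂ) ∞
        (f : PolyharmonicHardy.ComplexifiedAnnulus a b (n + 1) → ℂ)) := by
  have hLin := PolyharmonicHardy.coe_range_synthesis hY ha hab hL
  set T := PolyharmonicHardy.synthesis hY ha hab hL
  have hinj : Function.Injective T := PolyharmonicHardy.synthesis_injective hY ha hab hL
  set E := LinearEquiv.ofInjective T hinj
  refine ⟨fun c hc => ⟨_, hc.hasHardyExpansion hY ha hab hL⟩, LinearMap.range T,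
    PolyharmonicHardy.transportCore E, hLin, fun f g c e hf hg => ?_,
    PolyharmonicHardy.completeFor_transportCore E, fun K _ => ?_, fun f => ?_⟩
  · obtain ⟨v, rfl⟩ := E.surjective f
    obtain ⟨u, rfl⟩ := E.surjective g
    have h := PolyharmonicHardy.hasSum_inner_of_hasHardyExpansion hY ha hab hL hf hg
    have hin : (PolyharmonicHardy.transportCore E).inner (E u) (E v) = inner ℂ u v := by
      change inner ℂ (E.symm (E u)) (E.symm (E v)) = inner ℂ u v
      rw [E.symm_apply_apply, E.symm_apply_apply]
    rw [hin]
    exact h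
  · obtain ⟨C, hC, h⟩ := PolyharmonicHardy.exists_norm_synthesis_le hY ha hab hL
    refine ⟨C, hC, fun f p _ => ?_⟩
    obtain ⟨v, rfl⟩ := E.surjective f
    rw [PolyharmonicHardy.normOf_transportCore]
    exact h v p
  · obtain ⟨v, rfl⟩ := E.surjective f
    exact PolyharmonicHardy.contMDiff_synthesis hY ha hab hL v
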